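/- Let $\mathcal X,\mathcal Y$ be finite alphabets, let $P_{XY}$ be a probability distribution on $\mathcal X\times\mathcal Y$, and suppose that the side information is a deterministic function of the source, i.e. $Y=f(X)$ almost surely for some $f:\mathcal X\to\mathcal Y$. All logarithms are to base 2, and exponents take values in $[0,\infty]$ with $\inf\emptyset=\infty$. *Notation.* The characteristic graph $G_X$ has vertex set $\mathcal X$; distinct $x,x'$ are adjacent iff $P_{XY}(x,y)P_{XY}(x',y)>0$ for some $y\in\mathcal Y$. Its chromatic number is $\gamma(G_X)$. For a graph $G$ on $\mathcal X$ and a distribution $Q$ on $\mathcal X$, $$\kappa(G,Q)=\max\Big\{-\sum_{a,b}Q(a)V(b|a)\log V(b|a)\;:\; V \text{ a stochastic matrix},\ QV=Q,\ V(b|a)=0 \text{ unless } a=b \text{ or } a,b \text{ are adjacent in } G\Big\}.$$ For $R\ge 0$ let $$e(R,P_{XY})=\inf_{Q_{XY}:\ \min(\kappa(G_X,Q_X),\,\log\gamma(G_X))\ge R}\Big[D(Q_{XY}\|P_{XY})+\max(0,\,R-H_Q(X|Y))\Big],$$ $$e_{SP}(R,P_{XY})=\inf_{Q_{XY}:\ H_Q(X|Y)\ge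 R}D(Q_{XY}\|P_{XY}),$$ where $Q_{XY}$ ranges over all probability distributions on $\mathcal X\times\mathcal Y$ and $Q_X$ is its $\mathcal X$-marginal. Let $(X_i,Y_i)$ be i.i.d. with distribution $P_{XY}$, and define the (lossless) reliability function $$\theta(R,P_{XY})=\lim_{\epsilon\downarrow0}\ \liminf_{n\to\infty}\ -\frac1n\log\Big[\min_{(\psi,\varphi)}\Pr\big(\varphi(\psi(X^n),Y^n)\ne X^n\big)\Big],$$ the minimum being over all pairs $\psi:\mathcal X^n\to\mathcal M$, $\varphi:\mathcal M\times\mathcal Y^n\to\mathcal X^n$ with $\mathcal M$ a finite set and $\frac1n\log|\mathcal M|\le R+\epsilon$. *Claim.* For every $R\ge0$: 1. $e(R,P_{XY})=e_{SP}(R,P_{XY})$; 2. if $R\ne\log\gamma(G_X)$, then the limit defining $\theta(R,P_{XY})$ exists and $\theta(R,P_{XY})=e_{SP}(R,P_{XY})$; 3. if $R=\log\gamma(G_X)$, then the limit defining $\theta(R,P_{XY})$ exists and $\theta(R,P_{XY})=\infty$. In particular the lossless reliability function is determined at all rates. -/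

import Mathlib

open Filter Topology

noncomputable section

namespace SideInfo

/-! Probability distributions on a finite alphabet `α` are the elements of `stdSimplex ℝ α`.
All logarithms are to base 2. Exponents take values in `EReal`, so that they may be `⊤ = ∞`. -/

/-- The relative entropy `D(Q ‖ P)` in bits of distributions on a finite alphabet;
it is `∞` unless `Q ≪ P`. -/
def relEntropy {α : Type*} [Fintype α] (Q P : α → ℝ) : EReal :=
  open Classical in
  if ∀ a, P a = 0 → Q a = 0 then ((∑ a, Q a * Real.logb 2 (Q a / P a) : ℝ) : EReal) else ⊤

/-- The measure on a finite type with point masses `Q`. -/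
def pointMassMeasure {α : Type*} [Fintype α] [MeasurableSpace α] (Q : α → ℝ) :
    MeasureTheory.Measure α :=
  ∑ a, ENNReal.ofReal (Q a) • MeasureTheory.Measure.dirac a

open MeasureTheory InformationTheory in
/-- `relEntropy` is the Kullback-Leibler divergence of Mathlib, converted to bits. -/
theorem relEntropy_eq_klDiv {α : Type*} [Fintype α] [MeasurableSpace α] [MeasurableSingletonClass α]
    (Q P : α → ℝ) (hQ : Q ∈ stdSimplex ℝ α) (hP : P ∈ stdSimplex ℝ α) :
    relEntropy Q P = ((klDiv (pointMassMeasure Q) (pointMassMeasure P) / ENNReal.ofReal (Real.log 2) : ENNReal) : EReal) := by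
  classical
  have hs : ∀ (R : α → ℝ) (a : α), pointMassMeasure R {a} = ENNReal.ofReal (R a) := by
    intro R a
    simp [pointMassMeasure, Measure.finsetSum_apply, Set.indicator_apply, Finset.sum_ite_eq']
  have hprob : ∀ R ∈ stdSimplex ℝ α, IsProbabilityMeasure (pointMassMeasure R) := by
    intro R hR
    refine ⟨?_⟩
    simp only [pointMassMeasure, Measure.finsetSum_apply, Measure.smul_apply, measure_univ, smul_eq_mul, mul_one]
    rw [← ENNReal.ofReal_sum_of_nonneg (fun i _ => hR.1 i), hR.2, ENNReal.ofReal_one]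
  have := hprob Q hQ
  have := hprob P hP
  have hac : pointMassMeasure Q ≪ pointMassMeasure P ↔ ∀ a, P a = 0 → Q a = 0 := by
    constructor
    · intro h a ha
      have := h (show pointMassMeasure P {a} = 0 by simp [hs, ha])
      rw [hs, ENNReal.ofReal_eq_zero] at this
      exact le_antisymm this (hQ.1 a)
    · intro h s hs0
      have h1 : ∀ a ∈ s, pointMassMeasure Q {a} = 0 := by
        intro a ha
        have := measure_mono_null (Set.singleton_subset_iff.2 ha) hs0
        rw [hs, ENNReal.ofReal_eq_zero] at this
        rw [hs, h a (le_antisymm this (hP.1 a)), ENNReal.ofReal_zero]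
      rw [← Set.biUnion_of_singleton s]
      exact (measure_biUnion_null_iff s.to_countable).2 h1
  unfold relEntropy
  by_cases h : pointMassMeasure Q ≪ pointMassMeasure P
  · rw [if_pos (hac.1 h)]
    have hint : Integrable (llr (pointMassMeasure Q) (pointMassMeasure P)) (pointMassMeasure Q) := Integrable.of_finite
    have hrn : ∀ a, P a ≠ 0 → ((pointMassMeasure Q).rnDeriv (pointMassMeasure P) a).toReal = Q a / P a := by
      intro a ha
      have h1 := Measure.withDensity_rnDeriv_eq _ _ h
      have h2 := congrArg (fun μ : Measure α => μ {a}) h1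
      simp only [withDensity_apply _ (measurableSet_singleton a), lintegral_singleton, hs] at h2
      have h3 := congrArg ENNReal.toReal h2
      rw [ENNReal.toReal_mul, ENNReal.toReal_ofReal (hP.1 a), ENNReal.toReal_ofReal (hQ.1 a)] at h3
      field_simp
      exact h3
    have hsum : ∫ a, llr (pointMassMeasure Q) (pointMassMeasure P) a ∂(pointMassMeasure Q) = ∑ a, Q a * Real.log (Q a / P a) := by
      rw [integral_fintype hint]
      refine Finset.sum_congr rfl fun a _ => ?_
      rw [measureReal_def, hs, ENNReal.toReal_ofReal (hQ.1 a), smul_eq_mul]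
      by_cases ha : P a = 0
      · rw [hac.1 h a ha]; simp
      · rw [llr, hrn a ha]
    have hk : (klDiv (pointMassMeasure Q) (pointMassMeasure P)).toReal = ∑ a, Q a * Real.log (Q a / P a) := by
      rw [toReal_klDiv_of_measure_eq h (by simp), hsum]
    have hne : klDiv (pointMassMeasure Q) (pointMassMeasure P) ≠ ⊤ := klDiv_ne_top h hint
    have h2 : (0:ℝ) < Real.log 2 := Real.log_pos (by norm_num)
    rw [← ENNReal.ofReal_toReal hne, hk, ← ENNReal.ofReal_div_of_pos h2, EReal.coe_ennreal_ofReal,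
      max_eq_left]
    · simp [Real.logb, Finset.sum_div, mul_div_assoc]
    · rw [← hk]; positivity
  · rw [if_neg (fun h' => h (hac.2 h')), klDiv_of_not_ac h, ENNReal.top_div_of_ne_top (by simp)]
    simp

/-- The marginal `Q_X` of a joint distribution `Q_XY`. -/
def margX {X Y : Type*} [Fintype Y] (Q : X × Y → ℝ) : X → ℝ := fun x => ∑ y, Q (x, y)

/-- The marginal `Q_Y` of a joint distribution `Q_XY`. -/
def margY {X Y : Type*} [Fintype X] (Q : X × Y → ℝ) : Y → ℝ := fun y => ∑ x, Q (x, y)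

/-- The conditional entropy `H_Q(X|Y) = -∑ Q(x,y) log (Q(x,y) / Q_Y(y))` in bits. -/
def condEntropy {X Y : Type*} [Fintype X] [Fintype Y] (Q : X × Y → ℝ) : ℝ :=
  -∑ x, ∑ y, Q (x, y) * Real.logb 2 (Q (x, y) / margY Q y)

/-- The conditional entropy `H(V|Q) = -∑ Q(a) V(b|a) log V(b|a)` in bits of a channel `V`
(with `V a b` standing for `V(b|a)`) under the input distribution `Q`. -/
def channelEntropy {X : Type*} [Fintype X] (V : Matrix X X ℝ) (Q : X → ℝ) : ℝ :=
  -∑ a, Q a * ∑ b, V a b * Real.logb 2 (V a b)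

/-- `κ(G, Q)`: the maximum of `H(V|Q)` over the stochastic matrices `V` with `V ≪ G`
(that is, `V(b|a) = 0` unless `a = b` or `a` and `b` are adjacent) and `Q V = Q`.
The maximum is over a nonempty compact set. -/
def kappa {X : Type*} [Fintype X] (G : SimpleGraph X) (Q : X → ℝ) : ℝ :=
  sSup {h : ℝ | ∃ V : Matrix X X ℝ, (∀ a, V a ∈ stdSimplex ℝ X) ∧
    (∀ a b, ¬ (a = b ∨ G.Adj a b) → V a b = 0) ∧ Matrix.vecMul Q V = Q ∧
    h = channelEntropy V Q}

/-- The characteristic graph `G_X` of the source `P_XY`: distinct letters `x`, `x'` are adjacent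
when some `y` has positive probability together with each of them. -/
def charGraph {X Y : Type*} (P : X × Y → ℝ) : SimpleGraph X where
  Adj x x' := x ≠ x' ∧ ∃ y, 0 < P (x, y) ∧ 0 < P (x', y)
  symm := ⟨fun _ _ h => ⟨h.1.symm, h.2.imp fun _ hy => ⟨hy.2, hy.1⟩⟩⟩
  loopless := ⟨fun _ h => h.1 rfl⟩

/-- `log γ(G)`, with `γ(G)` the chromatic number (which is finite for a finite graph). -/
def logChrom {X : Type*} (G : SimpleGraph X) : ℝ := Real.logb 2 (G.chromaticNumber.toNat : ℝ)

/-- The achievable exponent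
`inf { D(Q_XY ‖ P_XY) + (R - H_Q(X|Y))⁺ : min (κ(G_X, Q_X), log γ(G_X)) ≥ R }`. -/
def graphExponent {X Y : Type*} [Fintype X] [Fintype Y] (P : X × Y → ℝ) (R : ℝ) : EReal :=
  ⨅ Q ∈ {Q : X × Y → ℝ | Q ∈ stdSimplex ℝ (X × Y) ∧
      R ≤ min (kappa (charGraph P) (margX Q)) (logChrom (charGraph P))},
    relEntropy Q P + ((max 0 (R - condEntropy Q) : ℝ) : EReal)

/-- The sphere-packing exponent `inf { D(Q_XY ‖ P_XY) : H_Q(X|Y) ≥ R }`. -/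
def spherePackingExponent {X Y : Type*} [Fintype X] [Fintype Y] (P : X × Y → ℝ) (R : ℝ) : EReal :=
  ⨅ Q ∈ {Q : X × Y → ℝ | Q ∈ stdSimplex ℝ (X × Y) ∧ R ≤ condEntropy Q}, relEntropy Q P

/-- The error probability `Pr(φ(ψ(Xⁿ), Yⁿ) ≠ Xⁿ)` of the code `(ψ, φ)` with message set `M`
when the pairs `(X_i, Y_i)` are i.i.d. with distribution `P`. -/
def errorProb {X Y : Type*} [Fintype X] [Fintype Y] (P : X × Y → ℝ) {n : ℕ} {M : Type*}
    (ψ : (Fin n → X) → M) (φ : M × (Fin n → Y) → (Fin n → X)) : ℝ :=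
  open Classical in
  ∑ x : Fin n → X, ∑ y : Fin n → Y,
    if φ (ψ x, y) ≠ x then ∏ i, P (x i, y i) else 0

/-- The minimum of the error probability over all codes of blocklength `n` whose message set `M`
satisfies `(1/n) log |M| ≤ r`; there is no loss in taking `M = {0, …, m - 1}`. -/
def minErrorProb {X Y : Type*} [Fintype X] [Fintype Y] (P : X × Y → ℝ) (n : ℕ) (r : ℝ) : ℝ :=
  sInf {p : ℝ | ∃ (m : ℕ) (ψ : (Fin n → X) → Fin m) (φ : Fin m × (Fin n → Y) → (Fin n → X)),
    1 / (n : ℝ) * Real.logb 2 (m : ℝ) ≤ r ∧ p = errorProb P ψ φ}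

/-- `-(1/n) log p`, which is `∞` for `p = 0`. -/
def decayRate (n : ℕ) (p : ℝ) : EReal :=
  open Classical in
  if p = 0 then ⊤ else ((-(1 / (n : ℝ)) * Real.logb 2 p : ℝ) : EReal)

/-- `θ(R, P_XY) = l`: the limit as `ε ↓ 0` of
`liminf_n -(1/n) log (min error probability at rate at most R + ε)` exists and equals `l`. -/
def HasReliability {X Y : Type*} [Fintype X] [Fintype Y] (P : X × Y → ℝ) (R : ℝ) (l : EReal) :
    Prop :=
  Tendsto (fun ε : ℝ => liminf (fun n : ℕ => decayRate n (minErrorProb P n (R + ε))) atTop)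
    (𝓝[>] 0) (𝓝 l)

end SideInfo

end

noncomputable section

namespace SideInfo

/-! When `Y = f(X)` almost surely, `P` lives on the graph of `f` and is determined by its marginal
`p`; any `Q` of finite divergence from `P` has the same form. Every quantity then becomes one about
a law `q ≪ p` on `X`, with `H_Q(X|Y)` equal to `fiberEntropy f q`. The characteristic graph is a
disjoint union of cliques, namely the fibres of `f` within the support of `p`, together with
isolated letters.

On such a graph `κ` collapses to the conditional entropy: Gibbs' inequality, applied to each row of
`V`, gives the upper bound, and resampling the letter given its image attains it
(`kappa_graphJoint`). The same inequality bounds the entropy by `log γ`, since `γ` is the size of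
the largest clique. Hence the constraint of `e` is that of `e_SP`, and its positive part vanishes.

For the reliability function, the encoder knows the side information. Achievability
(`minErrorProb_le_types`): index, separately for each value of `Yⁿ`, the sequences whose type has
conditional entropy below `R`; the failures lie in polynomially many type classes of divergence at
least `e_SP`. Converse (`le_errorProb`): change the measure to a `q` of conditional entropy above
the rate, under which any code must fail; Chebyshev's inequality converts this into an error of
about `2^(-n D(q‖p))` under `p`.

Rates slightly above `R` are allowed, so the converse needs a `q` with strict inequality. Below `log
γ`, mixing in the uniform law on a largest clique supplies one by concavity. From `log γ` on,
colouring letter by letter gives zero error, so the exponent is infinite; at `R = log γ` itself that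
uniform law keeps `e_SP` finite, whence the exception. -/

open Classical in
/-- The total `q`-mass of the letters with the same image under `f` as `a`. -/
def fiberMass {X Y : Type*} [Fintype X] (f : X → Y) (q : X → ℝ) (a : X) : ℝ :=
  ∑ b, if f b = f a then q b else 0

/-- The conditional entropy `H(X | f(X))` in bits of a source `X` with distribution `q`. -/
def fiberEntropy {X Y : Type*} [Fintype X] (f : X → Y) (q : X → ℝ) : ℝ :=
  -∑ a, q a * Real.logb 2 (q a / fiberMass f q a)

/-- The relative entropy in bits as a real number, meaningful for `q ≪ p`. -/
def relEntropyReal {X : Type*} [Fintype X] (q p : X → ℝ) : ℝ :=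
  ∑ a, q a * Real.logb 2 (q a / p a)

open Classical in
/-- The joint distribution of `(X, f(X))` when `X` has distribution `q`. -/
def graphJoint {X Y : Type*} (f : X → Y) (q : X → ℝ) : X × Y → ℝ :=
  fun z => if z.2 = f z.1 then q z.1 else 0

/-! ### Gibbs' inequality. -/

section Gibbs

/-- This is `log t ≤ t - 1` at `t = w / p`, multiplied by `p`. -/
theorem mul_logb_div_le {p w : ℝ} (hp : 0 ≤ p) (hw : 0 ≤ w) (h : 0 < p → 0 < w) :
    p * Real.logb 2 w - p * Real.logb 2 p ≤ (w - p) / Real.log 2 := by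
  have h2 : (0:ℝ) < Real.log 2 := Real.log_pos (by norm_num)
  rcases hp.eq_or_lt with rfl | hp
  · simp; positivity
  have hw' := h hp
  have h1 := Real.log_le_sub_one_of_pos (div_pos hw' hp)
  rw [Real.log_div hw'.ne' hp.ne'] at h1
  rw [Real.logb, Real.logb, le_div_iff₀ h2]
  have : (p * (Real.log w / Real.log 2) - p * (Real.log p / Real.log 2)) * Real.log 2
      = p * (Real.log w - Real.log p) := by field_simp
  rw [this]
  calc p * (Real.log w - Real.log p) ≤ p * (w / p - 1) := by gcongr
    _ = w - p := by field_simp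

/-- Gibbs' inequality. -/
theorem sum_mul_logb_le {α : Type*} [Fintype α] {p w : α → ℝ} (hp : ∀ a, 0 ≤ p a)
    (hw : ∀ a, 0 ≤ w a) (h : ∀ a, 0 < p a → 0 < w a) (hs : ∑ a, w a ≤ ∑ a, p a) :
    ∑ a, p a * Real.logb 2 (w a) ≤ ∑ a, p a * Real.logb 2 (p a) := by
  have h2 : (0:ℝ) < Real.log 2 := Real.log_pos (by norm_num)
  have h1 := Finset.sum_le_sum fun a (_ : a ∈ Finset.univ) =>
    mul_logb_div_le (hp a) (hw a) (h a)
  rw [Finset.sum_sub_distrib, ← Finset.sum_div, Finset.sum_sub_distrib] at h1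
  have : (∑ a, w a - ∑ a, p a) / Real.log 2 ≤ 0 :=
    div_nonpos_of_nonpos_of_nonneg (by linarith) h2.le
  linarith

end Gibbs

/-! ### Conditional entropy given the image under `f`. -/

section Fiber

variable {X Y : Type*} [Fintype X] {f : X → Y} {q : X → ℝ}

theorem fiberMass_congr (f : X → Y) (q : X → ℝ) {a b : X} (h : f a = f b) :
    fiberMass f q a = fiberMass f q b := by
  unfold fiberMass
  rw [h]

theorem fiberMass_nonneg (hq : ∀ a, 0 ≤ q a) (a : X) : 0 ≤ fiberMass f q a :=
  Finset.sum_nonneg fun b _ => by split_ifs <;> simp [hq]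

theorem le_fiberMass (hq : ∀ a, 0 ≤ q a) (a : X) : q a ≤ fiberMass f q a := by
  classical
  have := Finset.single_le_sum (f := fun b => if f b = f a then q b else 0)
    (fun b _ => by split_ifs <;> simp [hq]) (Finset.mem_univ a)
  simpa [fiberMass] using this

theorem fiberMass_pos (hq : ∀ a, 0 ≤ q a) {a : X} (ha : 0 < q a) : 0 < fiberMass f q a :=
  ha.trans_le (le_fiberMass hq a)

-- The conditional law given the image sums to one over a fibre of nonzero mass. For a fibre of zero
-- mass the convention `x / 0 = 0` makes the sum zero, hence the inequality.
open Classical in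
theorem sum_fiber_div_fiberMass_le_one (f : X → Y) (q : X → ℝ) (y : Y) :
    ∑ b, (if f b = y then q b / fiberMass f q b else 0) ≤ 1 := by
  by_cases h : ∃ a, f a = y
  · obtain ⟨a, rfl⟩ := h
    have : ∑ b, (if f b = f a then q b / fiberMass f q b else 0)
        = (∑ b, if f b = f a then q b else 0) / fiberMass f q a := by
      rw [Finset.sum_div]
      refine Finset.sum_congr rfl fun b _ => ?_
      split_ifs with hb
      · rw [fiberMass_congr f q hb]
      · simp
    rw [this]
    exact div_self_le_one _
  · push Not at h
    simp [h]

/-- Gibbs' inequality for the conditional entropy. -/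
theorem fiberEntropy_le (hq : ∀ a, 0 ≤ q a) {w : X → ℝ} (hw : ∀ a, 0 ≤ w a)
    (h : ∀ a, 0 < q a → 0 < w a)
    (hs : open Classical in ∀ y, ∑ a, (if f a = y then w a else 0) ≤ 1) :
    fiberEntropy f q ≤ -∑ a, q a * Real.logb 2 (w a) := by
  classical
  have hm := fiberMass_nonneg (f := f) hq
  -- The competitor `w · fiberMass` keeps the image law of `q` and replaces its conditional law by
  -- `w`; the image terms then cancel from both sides.
  have key := sum_mul_logb_le (p := q) (w := fun a => w a * fiberMass f q a) hq
    (fun a => mul_nonneg (hw a) (hm a)) (fun a ha => mul_pos (h a ha) (fiberMass_pos hq ha)) (by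
      calc ∑ a, w a * fiberMass f q a
          = ∑ b, ∑ a, if f b = f a then w a * q b else 0 := by
            simp only [fiberMass, Finset.mul_sum, mul_ite, mul_zero]
            rw [Finset.sum_comm]
        _ = ∑ b, q b * ∑ a, if f a = f b then w a else 0 := by
            refine Finset.sum_congr rfl fun b _ => ?_
            rw [Finset.mul_sum]
            refine Finset.sum_congr rfl fun a _ => ?_
            by_cases hab : f a = f b
            · simp [hab, mul_comm]
            · simp [hab, Ne.symm hab]
        _ ≤ ∑ b, q b * 1 := Finset.sum_le_sum fun b _ =>
            mul_le_mul_of_nonneg_left (by convert hs (f b)) (hq b)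
        _ = ∑ b, q b := by simp)
  rw [fiberEntropy, neg_le_neg_iff]
  have e1 : ∑ a, q a * Real.logb 2 (w a * fiberMass f q a)
      = ∑ a, q a * Real.logb 2 (w a) + ∑ a, q a * Real.logb 2 (fiberMass f q a) := by
    rw [← Finset.sum_add_distrib]
    refine Finset.sum_congr rfl fun a _ => ?_
    rcases (hq a).eq_or_lt with ha | ha
    · simp [← ha]
    · rw [Real.logb_mul (h a ha).ne' (fiberMass_pos hq ha).ne', mul_add]
  have e2 : ∑ a, q a * Real.logb 2 (q a / fiberMass f q a)
      = ∑ a, q a * Real.logb 2 (q a) - ∑ a, q a * Real.logb 2 (fiberMass f q a) := by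
    rw [← Finset.sum_sub_distrib]
    refine Finset.sum_congr rfl fun a _ => ?_
    rcases (hq a).eq_or_lt with ha | ha
    · simp [← ha]
    · rw [Real.logb_div ha.ne' (fiberMass_pos hq ha).ne', mul_sub]
  rw [e1] at key
  rw [e2]
  linarith

/-- Gibbs' inequality for `q₁` and for `q₂` is tested against the same `w`, the conditional law of
the mixture. The bound is linear in the law, so the weighted sum of the two bounds is exactly the
entropy of the mixture. The weights need not add up to one. -/
theorem fiberEntropy_concave {q₁ q₂ : X → ℝ} (h₁ : ∀ a, 0 ≤ q₁ a) (h₂ : ∀ a, 0 ≤ q₂ a)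
    {s t : ℝ} (hs : 0 < s) (ht : 0 < t) :
    s * fiberEntropy f q₁ + t * fiberEntropy f q₂ ≤ fiberEntropy f (s • q₁ + t • q₂) := by
  set q := s • q₁ + t • q₂ with hqdef
  have hqa : ∀ a, q a = s * q₁ a + t * q₂ a := fun a => by simp [hqdef]
  have hq : ∀ a, 0 ≤ q a := fun a => by
    rw [hqa]; exact add_nonneg (mul_nonneg hs.le (h₁ a)) (mul_nonneg ht.le (h₂ a))
  have hw : ∀ a, 0 ≤ q a / fiberMass f q a := fun a => div_nonneg (hq a) (fiberMass_nonneg hq a)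
  have hpos : ∀ a, 0 < q a → 0 < q a / fiberMass f q a :=
    fun a ha => div_pos ha (fiberMass_pos hq ha)
  have g₁ := fiberEntropy_le (f := f) h₁ hw (fun a ha => hpos a (by
    rw [hqa]; exact add_pos_of_pos_of_nonneg (mul_pos hs ha) (mul_nonneg ht.le (h₂ a))))
    (sum_fiber_div_fiberMass_le_one f q)
  have g₂ := fiberEntropy_le (f := f) h₂ hw (fun a ha => hpos a (by
    rw [hqa]; exact add_pos_of_nonneg_of_pos (mul_nonneg hs.le (h₁ a)) (mul_pos ht ha)))
    (sum_fiber_div_fiberMass_le_one f q)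
  have e : fiberEntropy f q = s * (-∑ a, q₁ a * Real.logb 2 (q a / fiberMass f q a))
      + t * (-∑ a, q₂ a * Real.logb 2 (q a / fiberMass f q a)) := by
    rw [fiberEntropy, mul_neg, mul_neg, ← neg_add, Finset.mul_sum, Finset.mul_sum,
      ← Finset.sum_add_distrib]
    congr 1
    refine Finset.sum_congr rfl fun a _ => ?_
    rw [show q a * Real.logb 2 (q a / fiberMass f q a)
      = (s * q₁ a + t * q₂ a) * Real.logb 2 (q a / fiberMass f q a) by rw [← hqa]]
    ring
  rw [e]
  exact add_le_add (mul_le_mul_of_nonneg_left g₁ hs.le) (mul_le_mul_of_nonneg_left g₂ ht.le)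

end Fiber

/-! ### Joint laws supported on the graph of `f`. -/

section Joint

variable {X Y : Type*} [Fintype X] [Fintype Y] {f : X → Y}

omit [Fintype X] in
theorem margX_graphJoint (f : X → Y) (q : X → ℝ) : margX (graphJoint f q) = q := by
  classical
  funext x
  simp [margX, graphJoint]

omit [Fintype X] [Fintype Y] in
theorem graphJoint_self (f : X → Y) (q : X → ℝ) (x : X) : graphJoint f q (x, f x) = q x := by
  simp [graphJoint]

omit [Fintype Y] in
theorem margY_graphJoint (f : X → Y) (q : X → ℝ) (x : X) :
    margY (graphJoint f q) (f x) = fiberMass f q x := by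
  classical
  simp only [margY, graphJoint, fiberMass]
  exact Finset.sum_congr rfl fun b _ => by simp only [eq_comm]

theorem graphJoint_mem_stdSimplex {q : X → ℝ} (hq : q ∈ stdSimplex ℝ X) :
    graphJoint f q ∈ stdSimplex ℝ (X × Y) := by
  refine ⟨fun z => ?_, ?_⟩
  · unfold graphJoint; split_ifs
    · exact hq.1 _
    · exact le_rfl
  · rw [Fintype.sum_prod_type]
    have := margX_graphJoint f q
    simp only [margX, funext_iff] at this
    simp [this, hq.2]

theorem margX_mem_stdSimplex {Q : X × Y → ℝ} (hQ : Q ∈ stdSimplex ℝ (X × Y)) :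
    margX Q ∈ stdSimplex ℝ X := by
  refine ⟨fun x => Finset.sum_nonneg fun y _ => hQ.1 _, ?_⟩
  rw [← hQ.2, Fintype.sum_prod_type]
  rfl

omit [Fintype X] in
theorem eq_graphJoint {Q : X × Y → ℝ} (h : ∀ x y, Q (x, y) ≠ 0 → y = f x) :
    Q = graphJoint f (margX Q) := by
  classical
  funext ⟨x, y⟩
  have h0 : ∀ y, y ≠ f x → Q (x, y) = 0 := fun y hy => by_contra fun h' => hy (h x y h')
  by_cases hy : y = f x
  · subst hy
    simp only [graphJoint, margX, if_true]
    rw [Finset.sum_eq_single (f x) (fun y _ hy => h0 y hy) (by simp)]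
  · simp [graphJoint, hy, h0 y hy]

theorem condEntropy_graphJoint (f : X → Y) (q : X → ℝ) :
    condEntropy (graphJoint f q) = fiberEntropy f q := by
  classical
  rw [condEntropy, fiberEntropy]
  congr 1
  refine Finset.sum_congr rfl fun x _ => ?_
  rw [Finset.sum_eq_single (f x), graphJoint_self, margY_graphJoint]
  · intro y _ hy
    simp [graphJoint, hy]
  · simp

theorem relEntropy_graphJoint {q p : X → ℝ} (h : ∀ a, p a = 0 → q a = 0) :
    relEntropy (graphJoint f q) (graphJoint f p) = (relEntropyReal q p : EReal) := by
  classical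
  rw [relEntropy, if_pos, Fintype.sum_prod_type, relEntropyReal]
  · congr 1
    refine Finset.sum_congr rfl fun x _ => ?_
    rw [Finset.sum_eq_single (f x), graphJoint_self, graphJoint_self]
    · intro y _ hy
      simp [graphJoint, hy]
    · simp
  · rintro ⟨x, y⟩
    simp only [graphJoint]
    split_ifs
    · exact h x
    · exact id

/-- Finite divergence means absolute continuity, which confines `Q` to the graph of `f`. -/
theorem eq_graphJoint_of_relEntropy_ne_top {Q : X × Y → ℝ} {p : X → ℝ}
    (hQ : Q ∈ stdSimplex ℝ (X × Y)) (h : relEntropy Q (graphJoint f p) ≠ ⊤) :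
    ∃ q ∈ stdSimplex ℝ X, (∀ a, p a = 0 → q a = 0) ∧ Q = graphJoint f q := by
  classical
  have hac : ∀ z, graphJoint f p z = 0 → Q z = 0 := by
    by_contra h'
    exact h (by rw [relEntropy, if_neg h'])
  have e : Q = graphJoint f (margX Q) := eq_graphJoint fun x y hxy => by
    by_contra hy
    exact hxy (hac _ (by simp [graphJoint, hy]))
  refine ⟨margX Q, margX_mem_stdSimplex hQ, fun a ha => ?_, e⟩
  have := hac (a, f a) (by rw [graphJoint_self, ha])
  rwa [e, graphJoint_self] at this

/-- For a deterministic side information the sphere-packing exponent only involves the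
distribution of the source. -/
theorem le_spherePackingExponent_iff {p : X → ℝ} {R : ℝ} {c : EReal} :
    c ≤ spherePackingExponent (graphJoint f p) R ↔ ∀ q ∈ stdSimplex ℝ X,
      (∀ a, p a = 0 → q a = 0) → R ≤ fiberEntropy f q → c ≤ (relEntropyReal q p : EReal) := by
  simp only [spherePackingExponent, le_iInf_iff, Set.mem_ofPred_eq]
  constructor
  · intro h q hq hac hR
    rw [← relEntropy_graphJoint (f := f) hac]
    exact h _ ⟨graphJoint_mem_stdSimplex hq, by rwa [condEntropy_graphJoint]⟩
  · rintro h Q ⟨hQ, hR⟩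
    by_cases ht : relEntropy Q (graphJoint f p) = ⊤
    · simp [ht]
    obtain ⟨q, hq, hac, rfl⟩ := eq_graphJoint_of_relEntropy_ne_top hQ ht
    rw [relEntropy_graphJoint hac]
    exact h q hq hac (by rwa [condEntropy_graphJoint] at hR)

end Joint

/-! ### The characteristic graph, `κ`, and equality of the two exponents. -/

section Graph

variable {X Y : Type*} [Fintype X] [Fintype Y] {f : X → Y} {p : X → ℝ}

-- This is the structure of the graph: its edges join exactly the distinct support letters of a
-- common fibre, so it is a union of cliques and isolated vertices.
omit [Fintype X] [Fintype Y] in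
theorem charGraph_graphJoint_adj {a b : X} : (charGraph (graphJoint f p)).Adj a b ↔
    a ≠ b ∧ f a = f b ∧ 0 < p a ∧ 0 < p b := by
  simp only [charGraph, graphJoint]
  refine and_congr_right fun _ => ⟨?_, ?_⟩
  · rintro ⟨y, h1, h2⟩
    split_ifs at h1 h2 with h3 h4
    · exact ⟨h3 ▸ h4, h1, h2⟩
    · exact absurd h2 (lt_irrefl _)
    · exact absurd h1 (lt_irrefl _)
    · exact absurd h1 (lt_irrefl _)
  · rintro ⟨h, h1, h2⟩
    exact ⟨f a, by simpa using h1, by simpa [h] using h2⟩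

/-- The chromatic number as a natural number. -/
def chrom (G : SimpleGraph X) : ℕ := G.chromaticNumber.toNat

theorem colorable_chrom (G : SimpleGraph X) : G.Colorable (chrom G) := by
  have h : G.chromaticNumber ≠ ⊤ := by
    rw [SimpleGraph.chromaticNumber_ne_top_iff_exists]
    exact ⟨_, G.colorable_of_fintype⟩
  rw [← SimpleGraph.chromaticNumber_le_iff_colorable, chrom, ENat.natCast_toNat h]

omit [Fintype X] in
theorem chrom_le {G : SimpleGraph X} {k : ℕ} (h : G.Colorable k) : chrom G ≤ k :=
  ENat.toNat_le_of_le_natCast (SimpleGraph.chromaticNumber_le_iff_colorable.2 h)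

theorem one_le_chrom [Nonempty X] (G : SimpleGraph X) : 1 ≤ chrom G := by
  obtain ⟨c⟩ := colorable_chrom G
  have := (c (Classical.arbitrary X)).pos
  exact this

omit [Fintype Y] in
theorem exists_coloring_injOn_fibers (f : X → Y) (p : X → ℝ) :
    ∃ c : X → Fin (chrom (charGraph (graphJoint f p))),
      ∀ a b, 0 < p a → 0 < p b → f a = f b → c a = c b → a = b := by
  obtain ⟨c⟩ := colorable_chrom (charGraph (graphJoint f p))
  refine ⟨c, fun a b ha hb hab hc => ?_⟩
  by_contra hne
  exact c.valid (charGraph_graphJoint_adj.2 ⟨hne, hab, ha, hb⟩) hc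

omit [Fintype Y] in
open Classical in
theorem card_fiber_le_chrom (f : X → Y) (p : X → ℝ) (y : Y) :
    (Finset.univ.filter fun a => f a = y ∧ 0 < p a).card ≤ chrom (charGraph (graphJoint f p)) := by
  obtain ⟨c, hc⟩ := exists_coloring_injOn_fibers f p
  have := Finset.card_le_card_of_injOn (s := Finset.univ.filter fun a => f a = y ∧ 0 < p a)
    (t := Finset.univ) c (fun _ _ => Finset.mem_coe.2 (Finset.mem_univ _)) (by
    intro a ha b hb hab
    simp only [Finset.coe_filter, Finset.mem_univ, true_and, Set.mem_ofPred_eq] at ha hb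
    exact hc a b ha.2 hb.2 (ha.1.trans hb.1.symm) hab)
  simpa using this

-- Each fibre of the support injects into a set as large as the largest one, and colours may be
-- reused across fibres because no edge joins them.
open Classical in
theorem exists_chrom_le_card_fiber (hp : ∃ a, 0 < p a) : ∃ y,
    chrom (charGraph (graphJoint f p)) ≤ (Finset.univ.filter fun a => f a = y ∧ 0 < p a).card := by
  obtain ⟨a₀, ha₀⟩ := hp
  have : Nonempty Y := ⟨f a₀⟩
  obtain ⟨y, -, hy⟩ := Finset.exists_max_image (Finset.univ : Finset Y)
    (fun y => (Finset.univ.filter fun a => f a = y ∧ 0 < p a).card) Finset.univ_nonempty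
  refine ⟨y, chrom_le ?_⟩
  set S : Y → Finset X := fun y => Finset.univ.filter fun a => f a = y ∧ 0 < p a with hS
  have hk : 0 < (S y).card := (Finset.card_pos.2 ⟨a₀, by simp [ha₀]⟩).trans_le
    (hy (f a₀) (Finset.mem_univ _))
  have hinj : ∀ y', ∃ g : X → Fin (S y).card, Set.InjOn g (S y') := fun y' => by
    have : Nonempty (Fin (S y).card) := ⟨⟨0, hk⟩⟩
    obtain ⟨g, -, hg⟩ := (Set.toFinite (S y' : Set X)).exists_injOn_of_encard_le
      (t := (Set.univ : Set (Fin (S y).card))) (by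
        rw [Set.encard_coe_eq_coe_finsetCard, Set.encard_univ, ENat.card_eq_coe_fintype_card,
          Fintype.card_fin]
        exact_mod_cast hy y' (Finset.mem_univ _))
    exact ⟨g, hg⟩
  choose g hg using hinj
  refine ⟨SimpleGraph.Coloring.mk (fun a => g (f a) a) fun {a b} hab h => ?_⟩
  obtain ⟨hne, hf, ha, hb⟩ := charGraph_graphJoint_adj.1 hab
  refine hne (hg (f b) (by simp [hS, hf, ha]) (by simp [hS, hb]) ?_)
  simpa [hf] using h

-- Gibbs' inequality with the weight `1/γ` on the support of `p`: each fibre is a clique, so it has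
-- at most `γ` support letters and total weight at most one.
omit [Fintype Y] in
theorem fiberEntropy_le_logChrom [Nonempty X] {q : X → ℝ} (hp : ∀ a, 0 ≤ p a)
    (hq : q ∈ stdSimplex ℝ X)
    (hac : ∀ a, p a = 0 → q a = 0) :
    fiberEntropy f q ≤ logChrom (charGraph (graphJoint f p)) := by
  classical
  set k := chrom (charGraph (graphJoint f p)) with hk
  have hk1 : (0 : ℝ) < k := by exact_mod_cast one_le_chrom _
  have hqp : ∀ a, 0 < q a → 0 < p a := fun a ha =>
    (hp a).lt_of_ne fun h => ha.ne' (hac a h.symm)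
  have h := fiberEntropy_le (f := f) hq.1 (w := fun a => if 0 < p a then (k : ℝ)⁻¹ else 0)
    (fun a => by split_ifs <;> positivity)
    (fun a ha => by rw [if_pos (hqp a ha)]; positivity) (fun y => by
      have := card_fiber_le_chrom f p y
      simp only [← ite_and]
      rw [← Finset.sum_filter, Finset.sum_const, nsmul_eq_mul, ← div_eq_mul_inv, div_le_one hk1]
      exact_mod_cast this)
  refine h.trans_eq ?_
  have e : ∀ a, q a * Real.logb 2 (if 0 < p a then (k : ℝ)⁻¹ else 0) = q a * (-Real.logb 2 k) := by
    intro a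
    rcases (hq.1 a).eq_or_lt with ha | ha
    · simp [← ha]
    · rw [if_pos (hqp a ha), Real.logb_inv]
  simp only [e]
  rw [← Finset.sum_mul, hq.2, one_mul, neg_neg]
  rfl

/-- The uniform distribution on a largest clique attains the largest conditional entropy. -/
theorem exists_logChrom_le_fiberEntropy [Nonempty X] (hp : p ∈ stdSimplex ℝ X) :
    ∃ q ∈ stdSimplex ℝ X, (∀ a, p a = 0 → q a = 0) ∧
      logChrom (charGraph (graphJoint f p)) ≤ fiberEntropy f q := by
  classical
  have hex : ∃ a, 0 < p a := by
    by_contra h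
    push Not at h
    have := hp.2
    rw [Finset.sum_eq_zero fun a _ => le_antisymm (h a) (hp.1 a)] at this
    exact zero_ne_one this
  obtain ⟨y, hy⟩ := exists_chrom_le_card_fiber (f := f) hex
  set S := Finset.univ.filter fun a => f a = y ∧ 0 < p a with hS
  have hc1 : 1 ≤ chrom (charGraph (graphJoint f p)) := one_le_chrom _
  have hc : (0 : ℝ) < S.card := by exact_mod_cast (hc1.trans hy)
  set q : X → ℝ := fun a => if a ∈ S then (S.card : ℝ)⁻¹ else 0 with hqdef
  have hsum : ∑ a, q a = 1 := by
    simp only [hqdef]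
    rw [Finset.sum_ite_mem, Finset.univ_inter, Finset.sum_const, nsmul_eq_mul,
      mul_inv_cancel₀ hc.ne']
  have hfm : ∀ a ∈ S, fiberMass f q a = 1 := by
    intro a ha
    rw [← hsum, fiberMass]
    refine Finset.sum_congr rfl fun b _ => ?_
    have ha' : f a = y := by simp [hS] at ha; exact ha.1
    by_cases hb : b ∈ S
    · have hb' : f b = y := by simp [hS] at hb; exact hb.1
      simp [ha', hb']
    · simp [hqdef, hb]
  refine ⟨q, ⟨fun a => by simp only [hqdef]; split_ifs <;> positivity, hsum⟩, fun a ha => ?_, ?_⟩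
  · have : a ∉ S := by simp [hS, ha]
    simp [hqdef, this]
  · have e : ∀ a, q a * Real.logb 2 (q a / fiberMass f q a)
        = q a * (-Real.logb 2 S.card) := by
      intro a
      by_cases ha : a ∈ S
      · rw [hfm a ha, div_one, ← Real.logb_inv]
        simp [hqdef, ha]
      · simp [hqdef, ha]
    rw [fiberEntropy]
    simp only [e]
    rw [← Finset.sum_mul, hsum, one_mul, neg_neg, logChrom]
    refine Real.logb_le_logb_of_le (by norm_num) ?_ ?_
    · exact_mod_cast hc1
    · exact_mod_cast hy

omit [Fintype Y] in
/-- For a deterministic side information `κ(G_X, Q_X) = H_Q(X | Y)`. -/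
theorem kappa_graphJoint {q : X → ℝ} (hp : ∀ a, 0 ≤ p a) (hq : q ∈ stdSimplex ℝ X)
    (hac : ∀ a, p a = 0 → q a = 0) :
    kappa (charGraph (graphJoint f p)) q = fiberEntropy f q := by
  classical
  have hqp : ∀ a, 0 < q a → 0 < p a := fun a ha =>
    (hp a).lt_of_ne fun h => ha.ne' (hac a h.symm)
  refine IsGreatest.csSup_eq ⟨?_, ?_⟩
  -- The optimal channel resamples the letter from its conditional law given its image. Rows outside
  -- the support of `q` are set to the identity, only to keep `V` stochastic.
  · refine ⟨fun a b => if 0 < q a then (if f b = f a then q b / fiberMass f q b else 0)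
      else (if b = a then 1 else 0), ?_, ?_, ?_, ?_⟩
    · intro a
      by_cases ha : 0 < q a
      · simp only [ha, if_true]
        refine ⟨fun b => ?_, ?_⟩
        · dsimp only
          split_ifs
          · exact div_nonneg (hq.1 b) (fiberMass_nonneg hq.1 b)
          · exact le_rfl
        · have : ∀ b, (if f b = f a then q b / fiberMass f q b else 0)
              = (if f b = f a then q b else 0) / fiberMass f q a := by
            intro b
            split_ifs with hb
            · rw [fiberMass_congr f q hb]
            · simp
          simp only [this]
          rw [← Finset.sum_div]
          exact div_self (fiberMass_pos (f := f) hq.1 ha).ne'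
      · simp only [ha, if_false]
        refine ⟨fun b => by dsimp only; split_ifs <;> norm_num, by simp⟩
    · intro a b hab
      push Not at hab
      obtain ⟨hne, hab⟩ := hab
      dsimp only
      split_ifs with h1 h2 h3
      · by_cases hb : 0 < q b
        · exact absurd (charGraph_graphJoint_adj.2 ⟨hne, h2.symm, hqp a h1, hqp b hb⟩) hab
        · rw [le_antisymm (not_lt.1 hb) (hq.1 b), zero_div]
      · rfl
      · exact absurd h3.symm hne
      · rfl
    · funext b
      simp only [Matrix.vecMul, dotProduct]
      have : ∀ a, q a * (if 0 < q a then (if f b = f a then q b / fiberMass f q b else 0)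
          else (if b = a then 1 else 0)) = (if f a = f b then q a else 0) * (q b / fiberMass f q b) := by
        intro a
        rcases (hq.1 a).eq_or_lt with ha | ha
        · simp [← ha]
        · by_cases hab : f a = f b
          · simp [ha, hab]
          · simp [hab, ha, Ne.symm hab]
      simp only [this]
      rw [← Finset.sum_mul]
      change fiberMass f q b * _ = _
      rcases (hq.1 b).eq_or_lt with hb | hb
      · simp [← hb]
      · rw [mul_div_cancel₀ _ (fiberMass_pos (f := f) hq.1 hb).ne']
    · unfold fiberEntropy channelEntropy
      congr 1
      have : ∀ a, q a * ∑ b, (if 0 < q a then (if f b = f a then q b / fiberMass f q b else 0)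
          else (if b = a then 1 else 0)) * Real.logb 2 (if 0 < q a then
            (if f b = f a then q b / fiberMass f q b else 0) else (if b = a then 1 else 0))
          = ∑ b, (if f a = f b then q a else 0) *
              (q b / fiberMass f q b * Real.logb 2 (q b / fiberMass f q b)) := by
        intro a
        rcases (hq.1 a).eq_or_lt with ha | ha
        · simp [← ha]
        · rw [Finset.mul_sum]
          refine Finset.sum_congr rfl fun b _ => ?_
          by_cases hab : f a = f b
          · simp [ha, hab]
          · simp [hab, ha, Ne.symm hab]
      simp only [this]
      rw [Finset.sum_comm]
      refine Finset.sum_congr rfl fun b _ => ?_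
      rw [← Finset.sum_mul]
      change _ = fiberMass f q b * _
      rcases (hq.1 b).eq_or_lt with hb | hb
      · simp [← hb]
      · rw [← mul_assoc, mul_div_cancel₀ _ (fiberMass_pos (f := f) hq.1 hb).ne']
  · rintro h ⟨V, hV, hVG, hQV, rfl⟩
    set w : X → ℝ := fun b => q b / fiberMass f q b with hw
    have hVq : ∀ a b, 0 < q a → 0 < V a b → 0 < q b := fun a b ha hab => by
      have h1 := congrFun hQV b
      simp only [Matrix.vecMul, dotProduct] at h1
      rw [← h1]
      exact (mul_pos ha hab).trans_le (Finset.single_le_sum (f := fun a => q a * V a b)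
        (fun a _ => mul_nonneg (hq.1 a) ((hV a).1 b)) (Finset.mem_univ a))
    have hfV : ∀ a b, 0 < V a b → f b = f a := fun a b hab => by
      by_contra hne
      refine hab.ne' (hVG a b ?_)
      rintro (h | h)
      · exact hne (by rw [h])
      · exact hne (charGraph_graphJoint_adj.1 h).2.1.symm
    -- Row `a` of `V` is supported in the fibre of `a`, so Gibbs' inequality compares it with the
    -- conditional law `w`. Averaging over `a` with `QV = Q` then turns the comparison into the
    -- conditional entropy of `q`.
    have key : ∀ a, q a * ∑ b, V a b * Real.logb 2 (w b)
        ≤ q a * ∑ b, V a b * Real.logb 2 (V a b) := by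
      intro a
      rcases (hq.1 a).eq_or_lt with ha | ha
      · simp [← ha]
      refine mul_le_mul_of_nonneg_left ?_ ha.le
      have h1 := sum_mul_logb_le (p := V a) (w := fun b => if f b = f a then w b else 0)
        (hV a).1 (fun b => by
          split_ifs
          · exact div_nonneg (hq.1 b) (fiberMass_nonneg hq.1 b)
          · exact le_rfl)
        (fun b hb => by
          rw [if_pos (hfV a b hb)]
          exact div_pos (hVq a b ha hb) (fiberMass_pos hq.1 (hVq a b ha hb)))
        (by rw [(hV a).2]; exact sum_fiber_div_fiberMass_le_one f q (f a))
      refine le_trans (le_of_eq (Finset.sum_congr rfl fun b _ => ?_)) h1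
      rcases ((hV a).1 b).eq_or_lt with hb | hb
      · simp [← hb]
      · simp [hfV a b hb]
    have hsum : ∑ a, q a * ∑ b, V a b * Real.logb 2 (w b) = ∑ b, q b * Real.logb 2 (w b) := by
      simp only [Finset.mul_sum, ← mul_assoc]
      rw [Finset.sum_comm]
      refine Finset.sum_congr rfl fun b _ => ?_
      rw [← Finset.sum_mul]
      congr 1
      exact congrFun hQV b
    rw [channelEntropy, fiberEntropy, neg_le_neg_iff, ← hsum]
    exact Finset.sum_le_sum fun a _ => key a

/-- Once `κ` is the conditional entropy, which never exceeds `log γ`, the minimum in the constraint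
is redundant and the positive part is zero. -/
theorem graphExponent_graphJoint [Nonempty X] (hp : ∀ a, 0 ≤ p a) (R : ℝ) :
    graphExponent (graphJoint f p) R = spherePackingExponent (graphJoint f p) R := by
  apply le_antisymm
  · rw [le_spherePackingExponent_iff]
    intro q hq hac hR
    refine (iInf₂_le (graphJoint f q) ⟨graphJoint_mem_stdSimplex hq, ?_⟩).trans ?_
    rotate_left
    · rw [margX_graphJoint, kappa_graphJoint hp hq hac]
      exact le_min hR (hR.trans (fiberEntropy_le_logChrom hp hq hac))
    · rw [condEntropy_graphJoint, relEntropy_graphJoint hac, max_eq_left (by linarith)]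
      simp
  · refine le_iInf₂ fun Q hQ => ?_
    obtain ⟨hQ, hR⟩ := hQ
    by_cases ht : relEntropy Q (graphJoint f p) = ⊤
    · rw [ht, EReal.top_add_coe]
      exact le_top
    obtain ⟨q, hq, hac, rfl⟩ := eq_graphJoint_of_relEntropy_ne_top hQ ht
    rw [margX_graphJoint, kappa_graphJoint hp hq hac] at hR
    have hR' := hR.trans (min_le_left _ _)
    rw [condEntropy_graphJoint, relEntropy_graphJoint hac, max_eq_left (by linarith)]
    simpa using le_spherePackingExponent_iff.1 le_rfl q hq hac hR'

theorem spherePackingExponent_eq_top [Nonempty X] (hp : ∀ a, 0 ≤ p a) {R : ℝ}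
    (hR : logChrom (charGraph (graphJoint f p)) < R) :
    spherePackingExponent (graphJoint f p) R = ⊤ := by
  rw [← top_le_iff, le_spherePackingExponent_iff]
  intro q hq hac h
  exact absurd (fiberEntropy_le_logChrom hp hq hac) (not_le.2 (hR.trans_le h))

-- Each summand is continuous because `x log x` is; where `p a = 0` it vanishes identically by the
-- conventions for division and logarithm at zero.
omit [Fintype Y] in
theorem tendsto_relEntropyReal_combo (q₁ q₂ : X → ℝ) :
    Tendsto (fun t : ℝ => relEntropyReal ((1 - t) • q₁ + t • q₂) p) (𝓝[>] 0)
      (𝓝 (relEntropyReal q₁ p)) := by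
  have hcont : Continuous fun t : ℝ => relEntropyReal ((1 - t) • q₁ + t • q₂) p := by
    unfold relEntropyReal
    refine continuous_finsetSum _ fun a _ => ?_
    by_cases ha : p a = 0
    · simp [ha, continuous_const]
    · have e : ∀ x : ℝ, x * Real.logb 2 (x / p a)
          = (x * Real.log x - x * Real.log (p a)) / Real.log 2 := by
        intro x
        rcases eq_or_ne x 0 with rfl | hx
        · simp
        · rw [Real.logb, Real.log_div hx ha]; ring
      simp only [e, Pi.add_apply, Pi.smul_apply, smul_eq_mul]
      have h := Real.continuous_mul_log
      have hl : Continuous fun t : ℝ => (1 - t) * q₁ a + t * q₂ a := by fun_prop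
      exact ((h.comp hl).sub (hl.mul continuous_const)).div_const _
  have := (hcont.tendsto 0).mono_left (nhdsWithin_le_nhds (s := Set.Ioi 0))
  simpa using this

/-- Below the largest rate, every distribution in the constraint set of the sphere-packing
exponent can be perturbed to satisfy the constraint strictly, at a small cost. -/
theorem exists_relEntropyReal_lt [Nonempty X] (hp : p ∈ stdSimplex ℝ X) {R : ℝ} {c : ℝ}
    (hR : R < logChrom (charGraph (graphJoint f p))) {q : X → ℝ} (hq : q ∈ stdSimplex ℝ X)
    (hac : ∀ a, p a = 0 → q a = 0) (hqR : R ≤ fiberEntropy f q) (hc : relEntropyReal q p < c) :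
    ∃ q' ∈ stdSimplex ℝ X, (∀ a, p a = 0 → q' a = 0) ∧ R < fiberEntropy f q' ∧
      relEntropyReal q' p < c := by
  obtain ⟨q₂, hq₂, hac₂, hR₂⟩ := exists_logChrom_le_fiberEntropy (f := f) hp
  have h1 := (tendsto_relEntropyReal_combo (p := p) q q₂).eventually_lt_const hc
  have h2 : ∀ᶠ t : ℝ in 𝓝[>] 0, t < 1 :=
    (eventually_lt_nhds one_pos).filter_mono nhdsWithin_le_nhds
  have h3 : ∀ᶠ t : ℝ in 𝓝[>] 0, 0 < t := eventually_mem_nhdsWithin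
  obtain ⟨t, h1, h2, h3⟩ := (h1.and (h2.and h3)).exists
  refine ⟨(1 - t) • q + t • q₂, convex_stdSimplex ℝ X hq hq₂ (by linarith) h3.le (by ring),
    fun a ha => by simp [hac a ha, hac₂ a ha], ?_, h1⟩
  refine lt_of_lt_of_le ?_ (fiberEntropy_concave hq.1 hq₂.1 (by linarith : 0 < 1 - t) h3)
  have : R < fiberEntropy f q₂ := hR.trans_le hR₂
  nlinarith

end Graph

/-! ### The method of types. -/

section Sequences

variable {X : Type*} [Fintype X] {n : ℕ}

theorem prod_eq_rpow_sum_logb {ι : Type*} (s : Finset ι) {g : ι → ℝ} (hg : ∀ i ∈ s, 0 < g i) :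
    ∏ i ∈ s, g i = (2 : ℝ) ^ ∑ i ∈ s, Real.logb 2 (g i) := by
  rw [Real.rpow_sum_of_pos (by norm_num)]
  exact Finset.prod_congr rfl fun i hi =>
    (Real.rpow_logb (by norm_num) (by norm_num) (hg i hi)).symm

theorem sum_prod_eq_pow (n : ℕ) (q : X → ℝ) : ∑ x : Fin n → X, ∏ i, q (x i) = (∑ a, q a) ^ n := by
  classical
  rw [← Fintype.piFinset_univ, ← Finset.prod_univ_sum]
  simp

/-- The empirical distribution (type) of a sequence. -/
def empirical (x : Fin n → X) (a : X) : ℝ :=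
  open Classical in (∑ i, if x i = a then (1 : ℝ) else 0) / n

theorem sum_apply_eq (hn : n ≠ 0) (x : Fin n → X) (g : X → ℝ) :
    ∑ i, g (x i) = n * ∑ a, empirical x a * g a := by
  classical
  have hn' : (n : ℝ) ≠ 0 := by exact_mod_cast hn
  have : ∀ a, empirical x a * g a = (∑ i, if x i = a then g a else 0) / n := by
    intro a
    rw [empirical, div_mul_eq_mul_div, Finset.sum_mul]
    congr 1
    refine Finset.sum_congr rfl fun i _ => ?_
    split_ifs <;> simp
  simp only [this]
  rw [← Finset.sum_div, mul_div_cancel₀ _ hn', Finset.sum_comm]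
  simp

omit [Fintype X] in
theorem empirical_nonneg (x : Fin n → X) (a : X) : 0 ≤ empirical x a :=
  div_nonneg (Finset.sum_nonneg fun _ _ => by split_ifs <;> norm_num) (Nat.cast_nonneg n)

theorem empirical_mem_stdSimplex (hn : n ≠ 0) (x : Fin n → X) :
    empirical x ∈ stdSimplex ℝ X := by
  refine ⟨empirical_nonneg x, ?_⟩
  have hn' : (n : ℝ) ≠ 0 := by exact_mod_cast hn
  have := sum_apply_eq hn x fun _ => 1
  simp only [Finset.sum_const, Finset.card_univ, Fintype.card_fin, nsmul_eq_mul, mul_one] at this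
  exact mul_left_cancel₀ hn' (by rw [← this, mul_one])

omit [Fintype X] in
theorem empirical_pos (x : Fin n → X) (i : Fin n) : 0 < empirical x (x i) := by
  classical
  have hn : 0 < n := i.pos
  refine div_pos ?_ (by exact_mod_cast hn)
  exact Finset.sum_pos' (fun _ _ => by split_ifs <;> norm_num) ⟨i, Finset.mem_univ _, by simp⟩

omit [Fintype X] in
theorem exists_apply_eq_of_empirical_pos {x : Fin n → X} {a : X} (h : empirical x a ≠ 0) :
    ∃ i, x i = a := by
  classical
  by_contra hne
  push Not at hne
  exact h (by simp [empirical, hne])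

/-- There are at most `(n + 1) ^ |X|` types. -/
theorem sum_le_of_types {S : Finset (Fin n → X)} {F : (Fin n → X) → ℝ} {B : ℝ} (hB : 0 ≤ B)
    (h : open Classical in ∀ x₀ ∈ S,
      ∑ x ∈ S.filter (fun x => empirical x = empirical x₀), F x ≤ B) :
    ∑ x ∈ S, F x ≤ ((n : ℝ) + 1) ^ Fintype.card X * B := by
  classical
  have hcard : (S.image empirical).card ≤ (n + 1) ^ Fintype.card X := by
    -- A type is determined by its letter counts, each in `{0, …, n}`.
    have hsub : S.image empirical ⊆ (Finset.univ : Finset (X → Fin (n + 1))).image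
        (fun k a => ((k a : ℕ) : ℝ) / n) := by
      intro t ht
      obtain ⟨x, -, rfl⟩ := Finset.mem_image.1 ht
      refine Finset.mem_image.2 ⟨fun a => ⟨(Finset.univ.filter fun i => x i = a).card, ?_⟩,
        Finset.mem_univ _, ?_⟩
      · have := Finset.card_filter_le (Finset.univ : Finset (Fin n)) fun i => x i = a
        simp only [Finset.card_univ, Fintype.card_fin] at this
        omega
      · funext a
        simp [empirical]
    refine (Finset.card_le_card hsub).trans (Finset.card_image_le.trans ?_)
    simp
  rw [← Finset.sum_fiberwise_of_maps_to (t := S.image empirical) (g := empirical)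
    fun x hx => Finset.mem_image_of_mem _ hx]
  calc ∑ t ∈ S.image empirical, ∑ x ∈ S.filter (fun x => empirical x = t), F x
      ≤ ∑ t ∈ S.image empirical, B := Finset.sum_le_sum fun t ht => by
        obtain ⟨x₀, hx₀, rfl⟩ := Finset.mem_image.1 ht
        convert h x₀ hx₀
    _ = (S.image empirical).card * B := by rw [Finset.sum_const, nsmul_eq_mul]
    _ ≤ _ := by
        refine mul_le_mul_of_nonneg_right ?_ hB
        exact_mod_cast hcard

open Classical in
/-- The probability of a type class. -/
theorem sum_typeClass_le (hn : n ≠ 0) {p : X → ℝ} (hp : ∀ a, 0 ≤ p a) (x₀ : Fin n → X)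
    (hac : ∀ a, p a = 0 → empirical x₀ a = 0) :
    ∑ x : Fin n → X with empirical x = empirical x₀, ∏ i, p (x i)
      ≤ (2 : ℝ) ^ (-(n * relEntropyReal (empirical x₀) p)) := by
  set q := empirical x₀ with hq
  have hqs := empirical_mem_stdSimplex hn x₀
  -- The likelihood ratio of `p` to `q` is constant on the type class, and the class has `q`-mass at
  -- most one.
  have e : ∀ x : Fin n → X, empirical x = q → ∏ i, p (x i)
      = (2 : ℝ) ^ (-(n * relEntropyReal q p)) * ∏ i, q (x i) := by
    intro x hx
    have hqx : ∀ i, 0 < q (x i) := fun i => hx ▸ empirical_pos x i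
    have hpx : ∀ i, 0 < p (x i) := fun i =>
      (hp _).lt_of_ne fun h => (hqx i).ne' (hac _ h.symm)
    have h1 : ∏ i, q (x i) / p (x i) = (2 : ℝ) ^ (n * relEntropyReal q p) := by
      rw [prod_eq_rpow_sum_logb _ fun i _ => div_pos (hqx i) (hpx i),
        sum_apply_eq hn x fun a => Real.logb 2 (q a / p a), hx]
      rfl
    rw [Real.rpow_neg (by norm_num), ← h1, Finset.prod_div_distrib]
    have h2 := (Finset.prod_pos fun i (_ : i ∈ Finset.univ) => hqx i).ne'
    have h3 := (Finset.prod_pos fun i (_ : i ∈ Finset.univ) => hpx i).ne'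
    field_simp
  calc ∑ x : Fin n → X with empirical x = q, ∏ i, p (x i)
      = ∑ x : Fin n → X with empirical x = q,
          (2 : ℝ) ^ (-(n * relEntropyReal q p)) * ∏ i, q (x i) :=
        Finset.sum_congr rfl fun x hx => e x (Finset.mem_filter.1 hx).2
    _ ≤ ∑ x : Fin n → X, (2 : ℝ) ^ (-(n * relEntropyReal q p)) * ∏ i, q (x i) :=
        Finset.sum_le_sum_of_subset_of_nonneg (Finset.filter_subset _ _) fun x _ _ =>
          mul_nonneg (by positivity) (Finset.prod_nonneg fun i _ => hqs.1 _)
    _ = _ := by rw [← Finset.mul_sum, sum_prod_eq_pow, hqs.2, one_pow, mul_one]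

open Classical in
/-- The number of sequences in a type class with given side information. -/
theorem card_typeClass_fiber_le {Y : Type*} (hn : n ≠ 0) (f : X → Y) (x₀ : Fin n → X)
    (y : Fin n → Y) :
    ((Finset.univ.filter fun x : Fin n → X =>
      empirical x = empirical x₀ ∧ ∀ i, f (x i) = y i).card : ℝ)
      ≤ (2 : ℝ) ^ (n * fiberEntropy f (empirical x₀)) := by
  set q := empirical x₀ with hq
  have hqs := empirical_mem_stdSimplex hn x₀
  set w : X → ℝ := fun a => q a / fiberMass f q a with hw
  have hw0 : ∀ a, 0 ≤ w a := fun a => div_nonneg (hqs.1 a) (fiberMass_nonneg hqs.1 a)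
  set S := Finset.univ.filter fun x : Fin n → X => empirical x = q ∧ ∀ i, f (x i) = y i
  -- Every counted sequence has conditional probability exactly `2^(-nH)` given `y`, and such
  -- probabilities sum to at most one.
  have e : ∀ x ∈ S, (1 : ℝ) = (2 : ℝ) ^ (n * fiberEntropy f q) *
      ∏ i, (if f (x i) = y i then w (x i) else 0) := by
    intro x hx
    obtain ⟨hx, hy⟩ := (Finset.mem_filter.1 hx).2
    have hqx : ∀ i, 0 < q (x i) := fun i => hx ▸ empirical_pos x i
    simp only [hy, if_true]
    rw [prod_eq_rpow_sum_logb _ fun i _ => div_pos (hqx i) (fiberMass_pos hqs.1 (hqx i)),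
      sum_apply_eq hn x fun a => Real.logb 2 (w a), hx, ← Real.rpow_add (by norm_num)]
    simp [fiberEntropy, hw]
  calc (S.card : ℝ) = ∑ x ∈ S, (1 : ℝ) := by simp
    _ = ∑ x ∈ S, (2 : ℝ) ^ (n * fiberEntropy f q) *
          ∏ i, (if f (x i) = y i then w (x i) else 0) := Finset.sum_congr rfl e
    _ ≤ ∑ x : Fin n → X, (2 : ℝ) ^ (n * fiberEntropy f q) *
          ∏ i, (if f (x i) = y i then w (x i) else 0) :=
        Finset.sum_le_sum_of_subset_of_nonneg (Finset.filter_subset _ _) fun x _ _ =>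
          mul_nonneg (by positivity) (Finset.prod_nonneg fun i _ => by
            split_ifs <;> simp [hw0])
    _ = (2 : ℝ) ^ (n * fiberEntropy f q) * ∏ i, ∑ a, (if f a = y i then w a else 0) := by
        rw [← Finset.mul_sum, Finset.prod_univ_sum, Fintype.piFinset_univ]
    _ ≤ (2 : ℝ) ^ (n * fiberEntropy f q) * 1 := by
        refine mul_le_mul_of_nonneg_left ?_ (by positivity)
        refine Finset.prod_le_one (fun i _ => Finset.sum_nonneg fun a _ => ?_) fun i _ => ?_
        · split_ifs <;> simp [hw0]
        · exact sum_fiber_div_fiberMass_le_one f q (y i)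
    _ = _ := mul_one _

end Sequences

/-! ### Codes and achievability. -/

section Codes

variable {X Y : Type*} [Fintype X] [Fintype Y] {f : X → Y} {p : X → ℝ} {n : ℕ}

open Classical in
theorem errorProb_graphJoint {M : Type*} (ψ : (Fin n → X) → M)
    (φ : M × (Fin n → Y) → (Fin n → X)) :
    errorProb (graphJoint f p) ψ φ
      = ∑ x : Fin n → X, if φ (ψ x, f ∘ x) ≠ x then ∏ i, p (x i) else 0 := by
  rw [errorProb]
  refine Finset.sum_congr rfl fun x _ => ?_
  rw [Finset.sum_eq_single (f ∘ x)]
  · simp [graphJoint]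
  · intro y _ hy
    obtain ⟨i, hi⟩ := Function.ne_iff.1 hy
    rw [Finset.prod_eq_zero (Finset.mem_univ i), ite_self]
    simpa [graphJoint] using fun h => absurd h hi
  · simp

theorem errorProb_nonneg {P : X × Y → ℝ} (hP : ∀ z, 0 ≤ P z) {M : Type*} (ψ : (Fin n → X) → M)
    (φ : M × (Fin n → Y) → (Fin n → X)) : 0 ≤ errorProb P ψ φ :=
  Finset.sum_nonneg fun _ _ => Finset.sum_nonneg fun _ _ => by
    split_ifs
    · exact Finset.prod_nonneg fun i _ => hP _
    · exact le_rfl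

theorem minErrorProb_nonneg {P : X × Y → ℝ} (hP : ∀ z, 0 ≤ P z) (n : ℕ) (r : ℝ) :
    0 ≤ minErrorProb P n r :=
  Real.sInf_nonneg fun _ ⟨_, ψ, φ, _, h⟩ => h ▸ errorProb_nonneg hP ψ φ

theorem minErrorProb_le {P : X × Y → ℝ} (hP : ∀ z, 0 ≤ P z) {r : ℝ} {m : ℕ}
    (hm : 1 / (n : ℝ) * Real.logb 2 (m : ℝ) ≤ r) (ψ : (Fin n → X) → Fin m)
    (φ : Fin m × (Fin n → Y) → (Fin n → X)) : minErrorProb P n r ≤ errorProb P ψ φ :=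
  csInf_le ⟨0, fun _ ⟨_, ψ, φ, _, h⟩ => h ▸ errorProb_nonneg hP ψ φ⟩ ⟨m, ψ, φ, hm, rfl⟩

omit [Fintype X] [Fintype Y] in
theorem graphJoint_nonneg (hp : ∀ a, 0 ≤ p a) (z : X × Y) : 0 ≤ graphJoint f p z := by
  unfold graphJoint
  split_ifs <;> simp [hp]

open Classical in
/-- Since the encoder can compute the side information, an encoder that separates the sequences
of `A` with equal side information only fails outside of `A`. -/
theorem minErrorProb_le_of_injOn_fibers [Nonempty X] (hp : ∀ a, 0 ≤ p a) {r : ℝ} {m : ℕ}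
    (hm : 1 / (n : ℝ) * Real.logb 2 (m : ℝ) ≤ r) (A : Finset (Fin n → X))
    (ψ : (Fin n → X) → Fin m)
    (hψ : ∀ x ∈ A, ∀ x' ∈ A, f ∘ x = f ∘ x' → ψ x = ψ x' → x = x') :
    minErrorProb (graphJoint f p) n r ≤ ∑ x ∈ Aᶜ, ∏ i, p (x i) := by
  set φ : Fin m × (Fin n → Y) → (Fin n → X) := fun z =>
    if h : ∃ x ∈ A, f ∘ x = z.2 ∧ ψ x = z.1 then h.choose else Classical.arbitrary _ with hφ
  refine (minErrorProb_le (graphJoint_nonneg hp) hm ψ φ).trans ?_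
  rw [errorProb_graphJoint, ← Finset.sum_filter]
  refine Finset.sum_le_sum_of_subset_of_nonneg (fun x hx => ?_) fun x _ _ =>
    Finset.prod_nonneg fun i _ => hp _
  rw [Finset.mem_compl]
  intro hA
  refine (Finset.mem_filter.1 hx).2 ?_
  have h : ∃ x' ∈ A, f ∘ x' = f ∘ x ∧ ψ x' = ψ x := ⟨x, hA, rfl, rfl⟩
  have e : φ (ψ x, f ∘ x) = h.choose := by
    simp only [hφ]
    exact dif_pos h
  rw [e]
  exact hψ _ h.choose_spec.1 _ hA h.choose_spec.2.1 h.choose_spec.2.2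

/-- Sending the colours of all letters uses `γ^n` messages, of rate exactly `log γ`. Colour and
image identify a letter of positive probability, so only sequences of probability zero can fail. -/
theorem minErrorProb_eq_zero [Nonempty X] (hp : ∀ a, 0 ≤ p a) (hn : n ≠ 0) {r : ℝ}
    (hr : logChrom (charGraph (graphJoint f p)) ≤ r) :
    minErrorProb (graphJoint f p) n r = 0 := by
  classical
  obtain ⟨c, hc⟩ := exists_coloring_injOn_fibers f p
  have hn' : (n : ℝ) ≠ 0 := by exact_mod_cast hn
  refine le_antisymm ?_ (minErrorProb_nonneg (graphJoint_nonneg hp) n r)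
  refine (minErrorProb_le_of_injOn_fibers hp
    (m := chrom (charGraph (graphJoint f p)) ^ n) ?_ (Finset.univ.filter fun x => ∀ i, 0 < p (x i))
    (fun x => finFunctionFinEquiv (c ∘ x)) ?_).trans_eq ?_
  · rw [Nat.cast_pow, Real.logb_pow, one_div, inv_mul_cancel_left₀ hn']
    exact hr
  · intro x hx x' hx' hf h
    have h' := finFunctionFinEquiv.injective h
    funext i
    exact hc _ _ ((Finset.mem_filter.1 hx).2 i) ((Finset.mem_filter.1 hx').2 i) (congrFun hf i)
      (congrFun h' i)
  · refine Finset.sum_eq_zero fun x hx => ?_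
    simp only [Finset.mem_compl, Finset.mem_filter, Finset.mem_univ, true_and, not_forall,
      not_lt] at hx
    obtain ⟨i, hi⟩ := hx
    exact Finset.prod_eq_zero (Finset.mem_univ i) (le_antisymm hi (hp _))

/-- The code handles the sequences whose type has conditional entropy below `R`: at most `poly(n) ·
2^(nR)` of them share a given side information. All other types have divergence at least `c` or
probability zero. The slack `ε` absorbs the number of types twice, in the rate and in the error. -/
theorem minErrorProb_le_types [Nonempty X] (hp : ∀ a, 0 ≤ p a) (hn : n ≠ 0) {R r ε c : ℝ}
    (hR : 0 ≤ R) (hr : R + ε ≤ r)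
    (h : ∀ q ∈ stdSimplex ℝ X, (∀ a, p a = 0 → q a = 0) → R ≤ fiberEntropy f q →
      c ≤ relEntropyReal q p)
    (hε : ((n : ℝ) + 1) ^ Fintype.card X ≤ (2 : ℝ) ^ (n * ε)) :
    minErrorProb (graphJoint f p) n r ≤ (2 : ℝ) ^ (n * (ε - c)) := by
  classical
  have hn' : (0 : ℝ) < n := by exact_mod_cast Nat.pos_of_ne_zero hn
  set A : Finset (Fin n → X) := Finset.univ.filter fun x => fiberEntropy f (empirical x) < R
    with hA
  set Af : (Fin n → Y) → Finset (Fin n → X) := fun y => A.filter fun x => ∀ i, f (x i) = y i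
    with hAf
  set N : ℝ := ((n : ℝ) + 1) ^ Fintype.card X * (2 : ℝ) ^ (n * R) with hN
  have hcard : ∀ y, ((Af y).card : ℝ) ≤ N := by
    intro y
    rw [Finset.card_eq_sum_ones, Nat.cast_sum]
    refine sum_le_of_types (by positivity) fun x₀ hx₀ => ?_
    have hx₀' : fiberEntropy f (empirical x₀) < R :=
      (Finset.mem_filter.1 (Finset.mem_filter.1 hx₀).1).2
    rw [← Nat.cast_sum, ← Finset.card_eq_sum_ones]
    refine le_trans ?_ ((card_typeClass_fiber_le hn f x₀ y).trans
      (Real.rpow_le_rpow_of_exponent_le (by norm_num) (by gcongr)))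
    norm_cast
    refine Finset.card_le_card fun x hx => ?_
    simp only [Finset.mem_filter, hAf, Finset.mem_univ, true_and] at hx ⊢
    exact ⟨hx.2, hx.1.2⟩
  -- The maximum with one keeps the message set nonempty even if no sequence is handled.
  set m : ℕ := max 1 (Finset.univ.sup fun y => (Af y).card) with hm
  have hm1 : 1 ≤ m := le_max_left _ _
  have hmA : ∀ y, (Af y).card ≤ m := fun y =>
    (Finset.le_sup (f := fun y => (Af y).card) (Finset.mem_univ y)).trans (le_max_right _ _)
  have hN1 : 1 ≤ N := by
    rw [hN]
    refine one_le_mul_of_one_le_of_one_le (one_le_pow₀ (by linarith)) ?_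
    exact Real.one_le_rpow (by norm_num) (by positivity)
  have hmN : (m : ℝ) ≤ N := by
    rw [hm, Nat.cast_max, Nat.cast_one]
    refine max_le hN1 ?_
    have hfl : Finset.univ.sup (fun y => (Af y).card) ≤ ⌊N⌋₊ :=
      Finset.sup_le fun y _ => Nat.le_floor (hcard y)
    exact (Nat.cast_le.2 hfl).trans (Nat.floor_le (by linarith))
  have hrate : 1 / (n : ℝ) * Real.logb 2 (m : ℝ) ≤ r := by
    refine le_trans ?_ hr
    rw [one_div, inv_mul_le_iff₀ hn', Real.logb_le_iff_le_rpow (by norm_num) (by positivity)]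
    refine hmN.trans ?_
    rw [show (n : ℝ) * (R + ε) = n * ε + n * R by ring, Real.rpow_add (by norm_num)]
    exact mul_le_mul_of_nonneg_right hε (by positivity)
  -- The indexing may depend on `y`, since the encoder computes `y = f ∘ x` itself.
  have hinj : ∀ y, ∃ g : (Fin n → X) → Fin m, Set.InjOn g (Af y) := fun y => by
    have : Nonempty (Fin m) := ⟨⟨0, hm1⟩⟩
    obtain ⟨g, -, hg⟩ := (Set.toFinite (Af y : Set (Fin n → X))).exists_injOn_of_encard_le
      (t := (Set.univ : Set (Fin m))) (by
        rw [Set.encard_coe_eq_coe_finsetCard, Set.encard_univ, ENat.card_eq_coe_fintype_card,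
          Fintype.card_fin]
        exact_mod_cast hmA y)
    exact ⟨g, hg⟩
  choose g hg using hinj
  refine (minErrorProb_le_of_injOn_fibers hp hrate A (fun x => g (f ∘ x) x) ?_).trans ?_
  · intro x hx x' hx' hf hgx
    rw [← hf] at hgx
    refine hg (f ∘ x) ?_ ?_ hgx
    · simp [hAf, hx]
    · simp only [hAf, Finset.coe_filter, Set.mem_ofPred_eq]
      exact ⟨hx', fun i => (congrFun hf i).symm⟩
  · rw [mul_sub, sub_eq_add_neg, Real.rpow_add (by norm_num)]
    refine (sum_le_of_types (B := (2 : ℝ) ^ (-(n * c))) (by positivity) fun x₀ hx₀ => ?_).trans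
      (by gcongr)
    have hx₀' : R ≤ fiberEntropy f (empirical x₀) := by
      simpa [hA] using hx₀
    by_cases hac : ∀ a, p a = 0 → empirical x₀ a = 0
    · refine le_trans (Finset.sum_le_sum_of_subset_of_nonneg (fun x hx => ?_) fun x _ _ =>
        Finset.prod_nonneg fun i _ => hp _) ((sum_typeClass_le hn hp x₀ hac).trans ?_)
      · simpa using (Finset.mem_filter.1 hx).2
      · refine Real.rpow_le_rpow_of_exponent_le (by norm_num) (neg_le_neg ?_)
        have := h _ (empirical_mem_stdSimplex hn x₀) hac hx₀'
        gcongr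
    · push Not at hac
      obtain ⟨a, ha, hxa⟩ := hac
      refine (Finset.sum_eq_zero fun x hx => ?_).trans_le (by positivity)
      rw [← (Finset.mem_filter.1 hx).2] at hxa
      obtain ⟨i, hi⟩ := exists_apply_eq_of_empirical_pos hxa
      exact Finset.prod_eq_zero (Finset.mem_univ i) (by rw [hi, ha])

theorem eventually_pow_le_rpow (k : ℕ) {ε : ℝ} (hε : 0 < ε) :
    ∀ᶠ n : ℕ in atTop, ((n : ℝ) + 1) ^ k ≤ (2 : ℝ) ^ (n * ε) := by
  have h2 : (1 : ℝ) < (2 : ℝ) ^ ε := Real.one_lt_rpow (by norm_num) hε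
  have h := tendsto_pow_const_div_const_pow_of_one_lt k h2
  have h' := (h.comp (tendsto_add_atTop_nat 1)).eventually_lt_const
    (show (0 : ℝ) < ((2 : ℝ) ^ ε)⁻¹ by positivity)
  filter_upwards [h'] with n hn
  simp only [Function.comp] at hn
  rw [div_lt_iff₀ (by positivity), pow_succ', inv_mul_cancel_left₀ (by positivity)] at hn
  rw [mul_comm, Real.rpow_mul (by norm_num), Real.rpow_natCast]
  exact_mod_cast hn.le

theorem le_decayRate {n : ℕ} (hn : n ≠ 0) {p c : ℝ} (hp : 0 ≤ p)
    (h : p ≤ (2 : ℝ) ^ (n * (-c))) : (c : EReal) ≤ decayRate n p := by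
  have hn' : (0 : ℝ) < n := by exact_mod_cast Nat.pos_of_ne_zero hn
  rw [decayRate]
  split_ifs with h0
  · exact le_top
  · rw [EReal.coe_le_coe_iff]
    have := (Real.logb_le_iff_le_rpow (by norm_num) (hp.lt_of_ne' h0)).2 h
    rw [neg_mul, le_neg, one_div, inv_mul_le_iff₀ hn']
    exact this

theorem decayRate_le {n : ℕ} (hn : n ≠ 0) {p c : ℝ}
    (h : (2 : ℝ) ^ (n * (-c)) ≤ p) : decayRate n p ≤ (c : EReal) := by
  have hn' : (0 : ℝ) < n := by exact_mod_cast Nat.pos_of_ne_zero hn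
  have hp : 0 < p := lt_of_lt_of_le (by positivity) h
  rw [decayRate, if_neg hp.ne', EReal.coe_le_coe_iff]
  have := (Real.le_logb_iff_rpow_le (by norm_num) hp).2 h
  rw [neg_mul, neg_le, one_div, le_inv_mul_iff₀ hn']
  exact this

/-- Achievability of the sphere-packing exponent. -/
theorem le_liminf_decayRate [Nonempty X] (hp : ∀ a, 0 ≤ p a) {R ε c c' : ℝ} (hR : 0 ≤ R)
    (hε : 0 < ε) (hc : c' < c)
    (h : ∀ q ∈ stdSimplex ℝ X, (∀ a, p a = 0 → q a = 0) → R ≤ fiberEntropy f q →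
      c ≤ relEntropyReal q p) :
    (c' : EReal) ≤ liminf (fun n => decayRate n (minErrorProb (graphJoint f p) n (R + ε))) atTop := by
  refine le_liminf_of_le (by isBoundedDefault) ?_
  have hδ : 0 < min ε (c - c') := lt_min hε (by linarith)
  filter_upwards [eventually_pow_le_rpow (Fintype.card X) hδ, eventually_ne_atTop 0] with n hn hn0
  refine le_decayRate hn0 (minErrorProb_nonneg (graphJoint_nonneg hp) n _) ?_
  have hmin := min_le_left ε (c - c')
  refine (minErrorProb_le_types hp hn0 hR (by linarith) h hn).trans
    (Real.rpow_le_rpow_of_exponent_le (by norm_num) ?_)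
  have := min_le_right ε (c - c')
  gcongr
  linarith

end Codes

/-! ### Second moments and change of measure for product laws. -/

section Chebyshev

variable {X : Type*} [Fintype X] {q : X → ℝ}

/-- Additivity of the variance, by splitting off one coordinate: the cross term vanishes because `h`
has mean zero. -/
theorem sum_prod_mul_sum_sq (hq : ∑ a, q a = 1) {h : X → ℝ} (h0 : ∑ a, q a * h a = 0) (n : ℕ) :
    ∑ x : Fin n → X, (∏ i, q (x i)) * (∑ i, h (x i)) ^ 2 = n * ∑ a, q a * h a ^ 2 := by
  induction n with
  | zero => simp
  | succ n ih =>
    rw [← Fintype.sum_equiv (Fin.consEquiv fun _ => X)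
      (fun z => (q z.1 * ∏ i, q (z.2 i)) * (h z.1 + ∑ i, h (z.2 i)) ^ 2) _ (fun z => by
        simp [Fin.consEquiv, Fin.prod_univ_succ, Fin.sum_univ_succ]), Fintype.sum_prod_type]
    have e : ∀ (a : X) (x : Fin n → X),
        (q a * ∏ i, q (x i)) * (h a + ∑ i, h (x i)) ^ 2
          = q a * h a ^ 2 * ∏ i, q (x i) + q a * h a * (2 * ((∏ i, q (x i)) * ∑ i, h (x i)))
            + q a * ((∏ i, q (x i)) * (∑ i, h (x i)) ^ 2) := fun a x => by ring
    simp only [e, Finset.sum_add_distrib, ← Finset.mul_sum, ← Finset.sum_mul]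
    rw [ih, h0, hq, sum_prod_eq_pow, hq]
    push_cast
    ring

open Classical in
/-- Chebyshev's inequality for sums of i.i.d. random variables on a finite alphabet. -/
theorem sum_prod_le_of_le_abs_sum (hq : q ∈ stdSimplex ℝ X) {h : X → ℝ}
    (h0 : ∑ a, q a * h a = 0) {n : ℕ} (hn : n ≠ 0) {δ : ℝ} (hδ : 0 < δ) :
    ∑ x : Fin n → X, (if n * δ ≤ |∑ i, h (x i)| then ∏ i, q (x i) else 0)
      ≤ (∑ a, q a * h a ^ 2) / δ ^ 2 / n := by
  have hn' : (0 : ℝ) < n := by exact_mod_cast Nat.pos_of_ne_zero hn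
  rw [div_div, le_div_iff₀ (by positivity)]
  refine le_of_mul_le_mul_left ?_ hn'
  rw [← sum_prod_mul_sum_sq hq.2 h0, mul_comm (n : ℝ), mul_assoc, Finset.sum_mul]
  refine Finset.sum_le_sum fun x _ => ?_
  have hx : 0 ≤ ∏ i, q (x i) := Finset.prod_nonneg fun i _ => hq.1 _
  split_ifs with hb
  · refine mul_le_mul_of_nonneg_left ?_ hx
    rw [← sq_abs (∑ i, h (x i))]
    calc δ ^ 2 * n * n = (n * δ) ^ 2 := by ring
      _ ≤ _ := by gcongr
  · rw [zero_mul]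
    positivity

omit [Fintype X] in
theorem prod_le_rpow_mul_prod {ι : Type*} [Fintype ι] {q v : X → ℝ} (hq : ∀ a, 0 ≤ q a)
    (hv : ∀ a, 0 ≤ v a) (h : ∀ a, 0 < q a → 0 < v a) {x : ι → X} {T : ℝ}
    (hT : ∑ i, Real.logb 2 (q (x i) / v (x i)) ≤ T) :
    ∏ i, q (x i) ≤ (2 : ℝ) ^ T * ∏ i, v (x i) := by
  by_cases h0 : ∃ i, q (x i) = 0
  · obtain ⟨i, hi⟩ := h0
    rw [Finset.prod_eq_zero (Finset.mem_univ i) hi]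
    exact mul_nonneg (by positivity) (Finset.prod_nonneg fun i _ => hv _)
  · push Not at h0
    have hqx : ∀ i, 0 < q (x i) := fun i => (hq _).lt_of_ne' (h0 i)
    have hvx : ∀ i, 0 < v (x i) := fun i => h _ (hqx i)
    have h2 : 0 < ∏ i, v (x i) := Finset.prod_pos fun i _ => hvx i
    rw [← div_le_iff₀ h2, ← Finset.prod_div_distrib,
      prod_eq_rpow_sum_logb _ fun i _ => div_pos (hqx i) (hvx i)]
    exact Real.rpow_le_rpow_of_exponent_le (by norm_num) hT

end Chebyshev

/-! ### The converse. -/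

section Converse

variable {X Y : Type*} [Fintype X] [Fintype Y] {f : X → Y} {p q : X → ℝ} {n : ℕ}

-- A correctly decoded sequence is recovered from its message and side information, so these pairs
-- are distinct. The summand is the probability of the side information, so each of the `m` messages
-- contributes at most one.
open Classical in
theorem sum_prod_fiberMass_le (hq : q ∈ stdSimplex ℝ X) {m : ℕ} (ψ : (Fin n → X) → Fin m)
    (φ : Fin m × (Fin n → Y) → (Fin n → X)) :
    ∑ x : Fin n → X with φ (ψ x, f ∘ x) = x, ∏ i, fiberMass f q (x i) ≤ m := by
  set qY : Y → ℝ := fun y => ∑ b, if f b = y then q b else 0 with hqY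
  have hqY0 : ∀ y, 0 ≤ qY y := fun y => Finset.sum_nonneg fun b _ => by
    split_ifs
    · exact hq.1 b
    · exact le_rfl
  have hqY1 : ∑ y, qY y = 1 := by
    rw [hqY, Finset.sum_comm, ← hq.2]
    simp
  set C := Finset.univ.filter fun x : Fin n → X => φ (ψ x, f ∘ x) = x
  set G : Fin m × (Fin n → Y) → ℝ := fun z => ∏ i, qY (z.2 i) with hG
  calc ∑ x ∈ C, ∏ i, fiberMass f q (x i)
      = ∑ x ∈ C, G (ψ x, f ∘ x) := Finset.sum_congr rfl fun x _ => rfl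
    _ = ∑ z ∈ C.image fun x => (ψ x, f ∘ x), G z := by
        rw [Finset.sum_image]
        intro x hx x' hx' h
        have h1 := (Finset.mem_filter.1 hx).2
        have h2 := (Finset.mem_filter.1 hx').2
        dsimp only at h
        rw [← h1, ← h2, h]
    _ ≤ ∑ z, G z := Finset.sum_le_sum_of_subset_of_nonneg (Finset.subset_univ _) fun z _ _ =>
        Finset.prod_nonneg fun i _ => hqY0 _
    _ = m := by
        rw [Fintype.sum_prod_type]
        simp only [hG]
        rw [sum_prod_eq_pow, hqY1]
        simp

/-- Change of measure: a lower bound for the error probability of a code of rate `r`. -/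
theorem le_errorProb (hp : ∀ a, 0 ≤ p a) (hq : q ∈ stdSimplex ℝ X)
    (hac : ∀ a, p a = 0 → q a = 0) (hn : n ≠ 0) {δ : ℝ} (hδ : 0 < δ) {r : ℝ} {m : ℕ}
    (hm : 1 / (n : ℝ) * Real.logb 2 (m : ℝ) ≤ r) (ψ : (Fin n → X) → Fin m)
    (φ : Fin m × (Fin n → Y) → (Fin n → X)) :
    1 - (∑ a, q a * (Real.logb 2 (q a / p a) - relEntropyReal q p) ^ 2) / δ ^ 2 / n
      - (∑ a, q a * (Real.logb 2 (q a / fiberMass f q a) + fiberEntropy f q) ^ 2) / δ ^ 2 / n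
      - (2 : ℝ) ^ (n * (r + δ - fiberEntropy f q))
      ≤ (2 : ℝ) ^ (n * (relEntropyReal q p + δ)) * errorProb (graphJoint f p) ψ φ := by
  classical
  have hn' : (0 : ℝ) < n := by exact_mod_cast Nat.pos_of_ne_zero hn
  have hqp : ∀ a, 0 < q a → 0 < p a := fun a ha =>
    (hp a).lt_of_ne fun h => ha.ne' (hac a h.symm)
  set D := relEntropyReal q p with hD
  set H := fiberEntropy f q with hH
  set g₁ : X → ℝ := fun a => Real.logb 2 (q a / p a) - D with hg₁
  set g₂ : X → ℝ := fun a => Real.logb 2 (q a / fiberMass f q a) + H with hg₂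
  have h₁ : ∑ a, q a * g₁ a = 0 := by
    simp only [hg₁, mul_sub, Finset.sum_sub_distrib, ← Finset.sum_mul, hq.2]
    rw [hD, relEntropyReal]
    ring
  have h₂ : ∑ a, q a * g₂ a = 0 := by
    simp only [hg₂, mul_add, Finset.sum_add_distrib, ← Finset.sum_mul, hq.2]
    rw [hH, fiberEntropy]
    ring
  have c₁ := sum_prod_le_of_le_abs_sum hq h₁ hn hδ
  have c₂ := sum_prod_le_of_le_abs_sum hq h₂ hn hδ
  have hm0 : (0 : ℝ) ≤ m := Nat.cast_nonneg m
  have hmr : (m : ℝ) ≤ (2 : ℝ) ^ (n * r) := by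
    rcases hm0.eq_or_lt with h | h
    · rw [← h]; positivity
    · rw [one_div, inv_mul_le_iff₀ hn', Real.logb_le_iff_le_rpow (by norm_num) h] at hm
      exact hm
  have hF : ∀ x : Fin n → X, 0 ≤ ∏ i, q (x i) := fun x => Finset.prod_nonneg fun i _ => hq.1 _
  -- Correct decoding: outside the deviation event, the `q`-probability of a sequence is at most
  -- `2^(n(δ - H))` times that of its side information, and the latter sum to at most `m ≤ 2^(nr)`.
  have c₃ : ∑ x : Fin n → X, (if φ (ψ x, f ∘ x) = x ∧ ¬ n * δ ≤ |∑ i, g₂ (x i)| then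
      ∏ i, q (x i) else 0) ≤ (2 : ℝ) ^ (n * (r + δ - H)) := by
    rw [show (n : ℝ) * (r + δ - H) = n * (δ - H) + n * r by ring, Real.rpow_add (by norm_num)]
    refine le_trans ?_ (mul_le_mul_of_nonneg_left ((sum_prod_fiberMass_le (f := f) hq ψ φ).trans hmr)
      (by positivity))
    rw [Finset.mul_sum, Finset.sum_filter]
    refine Finset.sum_le_sum fun x _ => ?_
    by_cases hx : φ (ψ x, f ∘ x) = x
    · simp only [hx, true_and, if_true]
      split_ifs with hb
      · exact mul_nonneg (by positivity)
          (Finset.prod_nonneg fun i _ => fiberMass_nonneg hq.1 _)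
      · refine prod_le_rpow_mul_prod hq.1 (fiberMass_nonneg hq.1)
          (fun a ha => fiberMass_pos hq.1 ha) ?_
        have := (le_abs_self _).trans (not_le.1 hb).le
        simp only [hg₂, Finset.sum_add_distrib, Finset.sum_const, Finset.card_univ,
          Fintype.card_fin, nsmul_eq_mul] at this
        linarith
    · simp [hx]
  -- Incorrect decoding: outside the deviation event, `q` exceeds `p` by a factor of at most `2^(n(D
  -- + δ))`.
  have c₄ : ∑ x : Fin n → X, (if φ (ψ x, f ∘ x) ≠ x ∧ ¬ n * δ ≤ |∑ i, g₁ (x i)| then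
      ∏ i, q (x i) else 0) ≤ (2 : ℝ) ^ (n * (D + δ)) * errorProb (graphJoint f p) ψ φ := by
    rw [errorProb_graphJoint, Finset.mul_sum]
    refine Finset.sum_le_sum fun x _ => ?_
    by_cases hx : φ (ψ x, f ∘ x) = x
    · simp [hx]
    · simp only [ne_eq, hx, not_false_eq_true, true_and, if_true]
      split_ifs with hb
      · exact mul_nonneg (by positivity) (Finset.prod_nonneg fun i _ => hp _)
      · refine prod_le_rpow_mul_prod hq.1 hp hqp ?_
        have := (le_abs_self _).trans (not_le.1 hb).le
        simp only [hg₁, Finset.sum_sub_distrib, Finset.sum_const, Finset.card_univ,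
          Fintype.card_fin, nsmul_eq_mul] at this
        linarith
  have total : (1 : ℝ) ≤ ∑ x : Fin n → X, (if n * δ ≤ |∑ i, g₁ (x i)| then ∏ i, q (x i) else 0)
      + ∑ x : Fin n → X, (if n * δ ≤ |∑ i, g₂ (x i)| then ∏ i, q (x i) else 0)
      + ∑ x : Fin n → X, (if φ (ψ x, f ∘ x) = x ∧ ¬ n * δ ≤ |∑ i, g₂ (x i)| then
          ∏ i, q (x i) else 0)
      + ∑ x : Fin n → X, (if φ (ψ x, f ∘ x) ≠ x ∧ ¬ n * δ ≤ |∑ i, g₁ (x i)| then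
          ∏ i, q (x i) else 0) := by
    have h1 : ∑ x : Fin n → X, ∏ i, q (x i) = 1 := by rw [sum_prod_eq_pow, hq.2, one_pow]
    rw [← h1, ← Finset.sum_add_distrib, ← Finset.sum_add_distrib, ← Finset.sum_add_distrib]
    refine Finset.sum_le_sum fun x _ => ?_
    have := hF x
    by_cases b₁ : n * δ ≤ |∑ i, g₁ (x i)| <;> by_cases b₂ : n * δ ≤ |∑ i, g₂ (x i)| <;>
      by_cases hx : φ (ψ x, f ∘ x) = x <;> simp [b₁, b₂, hx, this]
  linarith

/-- Converse to the sphere-packing exponent. -/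
theorem liminf_decayRate_le [Nonempty X] (hp : ∀ a, 0 ≤ p a) (hq : q ∈ stdSimplex ℝ X)
    (hac : ∀ a, p a = 0 → q a = 0) {r c : ℝ} (hr : 0 ≤ r) (hrH : r < fiberEntropy f q)
    (hc : relEntropyReal q p < c) :
    liminf (fun n => decayRate n (minErrorProb (graphJoint f p) n r)) atTop ≤ (c : EReal) := by
  -- With this `δ` the exponent `r + δ - H` is negative and `D + 2δ ≤ c`: one `δ` pays for the
  -- change of measure, the other for the vanishing factor `2^(-nδ)` put below the limit `1`.
  set δ := min ((c - relEntropyReal q p) / 2) ((fiberEntropy f q - r) / 2) with hδdef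
  have hδ : 0 < δ := lt_min (by linarith) (by linarith)
  have hδ₁ : δ ≤ (c - relEntropyReal q p) / 2 := min_le_left _ _
  have hδ₂ : δ ≤ (fiberEntropy f q - r) / 2 := min_le_right _ _
  have hpow : ∀ s : ℝ, s < 0 → Tendsto (fun n : ℕ => (2 : ℝ) ^ (n * s)) atTop (𝓝 0) := by
    intro s hs
    have := tendsto_pow_atTop_nhds_zero_of_lt_one (r := (2 : ℝ) ^ s) (by positivity)
      (Real.rpow_lt_one_of_one_lt_of_neg (by norm_num) hs)
    refine this.congr fun n => ?_
    rw [mul_comm, Real.rpow_mul (by norm_num), Real.rpow_natCast]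
  have hlim := (((tendsto_const_nhds (x := (1 : ℝ))).sub (tendsto_const_div_atTop_nhds_zero_nat
    ((∑ a, q a * (Real.logb 2 (q a / p a) - relEntropyReal q p) ^ 2) / δ ^ 2))).sub
    (tendsto_const_div_atTop_nhds_zero_nat ((∑ a, q a *
      (Real.logb 2 (q a / fiberMass f q a) + fiberEntropy f q) ^ 2) / δ ^ 2))).sub
    (hpow (r + δ - fiberEntropy f q) (by linarith))
  have hev := (hpow (-δ) (by linarith)).eventually_lt hlim (by norm_num)
  refine liminf_le_of_frequently_le' (Eventually.frequently ?_)
  filter_upwards [hev, eventually_ne_atTop 0] with n hn hn0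
  refine decayRate_le hn0 ?_
  -- A one-message code is admissible because `r ≥ 0`; without any code the infimum would default to
  -- zero.
  refine le_csInf ⟨_, 1, fun _ => 0, fun _ _ => Classical.arbitrary X, by simpa using hr, rfl⟩ ?_
  rintro _ ⟨m, ψ, φ, hm, rfl⟩
  have h := hn.le.trans (le_errorProb hp hq hac hn0 hδ hm ψ φ)
  have h2 : (0 : ℝ) < (2 : ℝ) ^ (n * (relEntropyReal q p + δ)) := by positivity
  refine le_of_mul_le_mul_left (le_trans ?_ h) h2
  rw [← Real.rpow_add (by norm_num)]
  refine Real.rpow_le_rpow_of_exponent_le (by norm_num) ?_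
  rw [← mul_add]
  gcongr
  linarith

end Converse

/-! ### The reliability function. -/

section Reliability

variable {X Y : Type*} [Fintype X] [Fintype Y] {f : X → Y} {p : X → ℝ}

theorem hasReliability_top [Nonempty X] (hp : ∀ a, 0 ≤ p a) {R : ℝ}
    (hR : logChrom (charGraph (graphJoint f p)) ≤ R) :
    HasReliability (graphJoint f p) R ⊤ := by
  refine tendsto_const_nhds.congr' ?_
  filter_upwards [eventually_mem_nhdsWithin] with ε hε
  have hε : 0 < ε := hε
  refine (Tendsto.liminf_eq (tendsto_const_nhds.congr' ?_)).symm
  filter_upwards [eventually_ne_atTop 0] with n hn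
  rw [minErrorProb_eq_zero hp hn (by linarith), decayRate, if_pos rfl]

theorem hasReliability_spherePackingExponent [Nonempty X] (hp : p ∈ stdSimplex ℝ X) {R : ℝ}
    (hR0 : 0 ≤ R) (hR : R < logChrom (charGraph (graphJoint f p))) :
    HasReliability (graphJoint f p) R (spherePackingExponent (graphJoint f p) R) := by
  refine tendsto_order.2 ⟨fun a ha => ?_, fun a ha => ?_⟩
  · obtain ⟨c', hac', hc'⟩ := EReal.lt_iff_exists_real_btwn.1 ha
    obtain ⟨c, hcc, hc⟩ := EReal.lt_iff_exists_real_btwn.1 hc'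
    filter_upwards [eventually_mem_nhdsWithin] with ε hε
    refine hac'.trans_le (le_liminf_decayRate hp.1 hR0 hε (EReal.coe_lt_coe_iff.1 hcc) ?_)
    intro q hq hac hqR
    exact EReal.coe_le_coe_iff.1 (le_spherePackingExponent_iff.1 hc.le q hq hac hqR)
  · obtain ⟨c, hc, hca⟩ := EReal.lt_iff_exists_real_btwn.1 ha
    have hex : ∃ q ∈ stdSimplex ℝ X, (∀ a, p a = 0 → q a = 0) ∧ R ≤ fiberEntropy f q ∧
        relEntropyReal q p < c := by
      by_contra h
      push Not at h
      refine absurd (le_spherePackingExponent_iff.2 fun q hq hac hqR => ?_) (not_le.2 hc)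
      exact EReal.coe_le_coe_iff.2 (h q hq hac hqR)
    obtain ⟨q, hq, hac, hqR, hqc⟩ := hex
    -- The strict inequality leaves room for the excess rate: `R + ε` stays below the entropy of
    -- `q'` for all small `ε`.
    obtain ⟨q', hq', hac', hqR', hqc'⟩ := exists_relEntropyReal_lt hp hR hq hac hqR hqc
    have hev : ∀ᶠ ε : ℝ in 𝓝[>] 0, ε < fiberEntropy f q' - R :=
      (eventually_lt_nhds (by linarith)).filter_mono nhdsWithin_le_nhds
    filter_upwards [hev, eventually_mem_nhdsWithin] with ε hε hε0
    have hε0 : 0 < ε := hε0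
    exact (liminf_decayRate_le hp.1 hq' hac' (by linarith) (by linarith) hqc').trans_lt hca

end Reliability

end SideInfo

end

theorem mainTheorem4 {X Y : Type*} [Fintype X] [Fintype Y] (P : X × Y → ℝ)
    (hP : P ∈ stdSimplex ℝ (X × Y)) (f : X → Y) (hf : ∀ x y, P (x, y) ≠ 0 → y = f x)
    (R : ℝ) (hR : 0 ≤ R) :
    SideInfo.graphExponent P R = SideInfo.spherePackingExponent P R ∧
    (R ≠ SideInfo.logChrom (SideInfo.charGraph P) →
      SideInfo.HasReliability P R (SideInfo.spherePackingExponent P R)) ∧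
    (R = SideInfo.logChrom (SideInfo.charGraph P) → SideInfo.HasReliability P R ⊤) := by
  have hp := SideInfo.margX_mem_stdSimplex hP
  have hX : Nonempty X := by
    by_contra h
    rw [not_nonempty_iff] at h
    simpa using hp.2
  rw [SideInfo.eq_graphJoint hf]
  set p := SideInfo.margX P
  refine ⟨SideInfo.graphExponent_graphJoint hp.1 R, fun hne => ?_, fun h =>
    SideInfo.hasReliability_top hp.1 h.ge⟩
  rcases hne.lt_or_gt with h | h
  · exact SideInfo.hasReliability_spherePackingExponent hp hR h
  · rw [SideInfo.spherePackingExponent_eq_top hp.1 h]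
    exact SideInfo.hasReliability_top hp.1 h.le
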